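/- Let $k$ be a commutative Noetherian ring, let $q_{i,j}\in k^*$ ($1\le i,j\le n$) satisfy $q_{i,i}=1$ and $q_{j,i}=q_{i,j}^{-1}$, and let $R=k_{\mathfrak q}[x_1,\ldots,x_n]$ be the skew polynomial ring, in which $k$ is central, $x_ix_j=q_{i,j}x_jx_i$, and the monomials $x^a=x_1^{a_1}\cdots x_n^{a_n}$ $(a\in\mathbb N^n)$ form a $k$-basis. For monomials put $x^a*x^b=x^{a+b}$, let $C(x^a,x^b)\in k^*$ be given by $x^ax^b=C(x^a,x^b)\,x^a*x^b$, and let $\max(x^a)$, $\min(x^a)$ be the largest and the smallest $i$ with $a_i>0$ (with $\max(1)<i<\min(1)$ for all $i$). Divisibility and quotients of monomials refer to $*$. Modules are right $R$-modules. Let $I$ be a stable ideal of $R$, i.e. a two-sided ideal generated by monomials such that for every monomial $w\in I$ and every $i<\max(w)$ the monomial $(x_i*w)/x_{\max(w)}$ lies in $I$. Let $G(I)$ be the minimal system of monomial generators of $I$. Every monomial $w\in I$ has a unique canonical decomposition $w=g(w)*y$ with $g(w)\in G(I)$ and $\max(g(w))\le\min(y)$. A symbol $e(\sigma;u)$, $\sigma=(i_1,\ldots,i_p)$,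 is admissible if $u\in G(I)$ and $1\le i_1<\cdots<i_p<\max(u)$. For such a symbol let $x_\sigma=x_{i_1}*\cdots*x_{i_p}$, let $\sigma_r$ be $\sigma$ without its $r$-th term, let $u_r=g(x_{i_r}*u)$, let $y_r$ be the monomial with $x_{i_r}*u=u_r*y_r$, and let $A(\sigma;u)$ be the set of those $r\in\{1,\ldots,p\}$ for which $e(\sigma_r;u_r)$ is admissible. Let $L_p(I)$ be the free right $R$-module on the admissible symbols $e(i_1,\ldots,i_p;u)$, $p\ge0$, let $d:L_p(I)\to L_{p-1}(I)$ $(p\ge1)$ be the $R$-linear map with $$d(e(\sigma;u))=\sum_{r=1}^{p}(-1)^r e(\sigma_r;u)\,C(x_{\sigma_r}*u,x_{i_r})^{-1}x_{i_r}-\sum_{r\in A(\sigma;u)}(-1)^r e(\sigma_r;u_r)\,C(x_{\sigma_r},y_r)^{-1}y_r ,$$ and let $\varepsilon:L_0(I)\to I$ be the $R$-linear map with $\varepsilon(e(\emptyset;u))=u$. Theorem. The complex $(L_\bullet(I),d)$ is a free resolution of $I$ over $R$: the modules $L_p(I)$ are free of finite rank and the sequence $$\cdots\to L_2(I)\xrightarrow{d}L_1(I)\xrightarrow{d}L_0(I)\xrightarrow{\varepsilon}I\to0$$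 is exact. It is $\mathbb Z\times G$-graded: here $\deg x_i=w_i$ for arbitrary positive integers $w_i$, $G$ is the group of automorphisms of $R$ generated by the automorphisms $\sigma_i$ with $\sigma_i(x_j)=q_{i,j}x_j$ (so that $x_ir=\sigma_i(r)x_i$ for $r\in R$), the monomial $x^a$ has $G$-degree $\sigma_1^{a_1}\cdots\sigma_n^{a_n}$, the symbol $e(\sigma;u)$ has the degree of $x_\sigma*u$, and $d$ and $\varepsilon$ preserve degrees. Moreover, if $k$ is a field, then the resolution is minimal, i.e. $d(L_p(I))\subseteq L_{p-1}(I)\,(x_1,\ldots,x_n)$ for all $p\ge1$. -/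

import Mathlib

noncomputable section

/-! ## Monomials

A monomial `x^a = x_1^{a_1} ⋯ x_n^{a_n}` is encoded by its exponent vector `a : Fin n →₀ ℕ`.
The commutative product `x^a * x^b` of the monoid of monomials is `a + b`. The variables are indexed
by `Fin n`, and `max(x^a)` is `a.support.max : WithBot (Fin n)`, so that `max(1) = ⊥`. -/

namespace SkewEK

/-- The scalar `C(x^a, x^b)` with `x^a x^b = C(x^a, x^b) x^(a+b)`. -/
def C {n : ℕ} {k : Type*} [CommRing k] (q : Fin n → Fin n → kˣ) (a b : Fin n →₀ ℕ) : kˣ :=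
  ∏ i, ∏ j ∈ Finset.Iio i, q i j ^ (a i * b j)

section Bicharacter

variable {n : ℕ} {k : Type*} [CommRing k] (q : Fin n → Fin n → kˣ)

theorem C_add_left (a b c : Fin n →₀ ℕ) : C q (a + b) c = C q a c * C q b c := by
  simp only [C, Finsupp.add_apply, add_mul, pow_add, Finset.prod_mul_distrib]

theorem C_add_right (a b c : Fin n →₀ ℕ) : C q a (b + c) = C q a b * C q a c := by
  simp only [C, Finsupp.add_apply, mul_add, pow_add, Finset.prod_mul_distrib]

theorem C_zero_left (a : Fin n →₀ ℕ) : C q 0 a = 1 := by simp [C]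

theorem C_zero_right (a : Fin n →₀ ℕ) : C q a 0 = 1 := by simp [C]

theorem C_eq_one (a b : Fin n →₀ ℕ) (h : ∀ i ∈ a.support, ∀ j ∈ b.support, i ≤ j) :
    C q a b = 1 := by
  refine Finset.prod_eq_one fun i _ => Finset.prod_eq_one fun j hj => ?_
  by_cases hi : a i = 0
  · simp [hi]
  · by_cases hj' : b j = 0
    · simp [hj']
    · exact absurd (h i (by simpa using hi) j (by simpa using hj'))
        (not_le.2 (Finset.mem_Iio.1 hj))

theorem C_single (i j : Fin n) :
    C q (Finsupp.single i 1) (Finsupp.single j 1) = if j < i then q i j else 1 := by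
  unfold C
  rw [Finset.prod_eq_single i]
  · split_ifs with h
    · rw [Finset.prod_eq_single j]
      · simp
      · intro b _ hb
        simp [hb.symm]
      · intro h'
        exact absurd (Finset.mem_Iio.2 h) h'
    · refine Finset.prod_eq_one fun b hb => ?_
      have : j ≠ b := by
        rintro rfl
        exact h (Finset.mem_Iio.1 hb)
      simp [this]
  · intro b _ hb
    refine Finset.prod_eq_one fun c _ => ?_
    simp [hb.symm]
  · simp

end Bicharacter

/-! ## The skew polynomial ring -/

/-- The skew polynomial ring `k_q[x_1, …, x_n]`: the free `k`-module on the monomials, with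
the multiplication determined by `x_i x_j = q_{ij} x_j x_i`, that is
`(r x^a) (s x^b) = r s C(x^a, x^b) x^(a+b)`. -/
def SkewPoly {n : ℕ} {k : Type*} [CommRing k] (_q : Fin n → Fin n → kˣ) : Type _ :=
  (Fin n →₀ ℕ) →₀ k

namespace SkewPoly

variable {n : ℕ} {k : Type*} [CommRing k] (q : Fin n → Fin n → kˣ)

instance : AddCommGroup (SkewPoly q) := inferInstanceAs (AddCommGroup ((Fin n →₀ ℕ) →₀ k))

instance : Module k (SkewPoly q) := inferInstanceAs (Module k ((Fin n →₀ ℕ) →₀ k))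

/-- The coefficients of an element, as a finitely supported function on the monomials. -/
def coeffs : SkewPoly q ≃ₗ[k] ((Fin n →₀ ℕ) →₀ k) := LinearEquiv.refl k _

/-- The term `r x^a`. -/
def term (a : Fin n →₀ ℕ) : k →ₗ[k] SkewPoly q :=
  (coeffs q).symm.toLinearMap ∘ₗ Finsupp.lsingle a

/-- The `k`-linear map on `R` with given restrictions to the summands `k x^a`. -/
def linLift {M : Type*} [AddCommGroup M] [Module k M] (φ : (Fin n →₀ ℕ) → k →ₗ[k] M) :
    SkewPoly q →ₗ[k] M :=
  Finsupp.lsum k φ ∘ₗ (coeffs q).toLinearMap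

theorem linLift_term {M : Type*} [AddCommGroup M] [Module k M] (φ : (Fin n →₀ ℕ) → k →ₗ[k] M)
    (a : Fin n →₀ ℕ) (r : k) : linLift q φ (term q a r) = φ a r := by
  simp [linLift, term]

/-- The monomial `x^a`. -/
def monomial (a : Fin n →₀ ℕ) : SkewPoly q := term q a 1

/-- The variable `x_i`. -/
def X (i : Fin n) : SkewPoly q := monomial q (Finsupp.single i 1)

/-- The multiplication as a bilinear map. -/
def mulLin : SkewPoly q →ₗ[k] SkewPoly q →ₗ[k] SkewPoly q :=
  linLift q fun a => LinearMap.toSpanSingleton k (SkewPoly q →ₗ[k] SkewPoly q)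
    (linLift q fun b => (C q a b : k) • term q (a + b))

theorem induction_term {p : SkewPoly q → Prop} (f : SkewPoly q) (h0 : p 0)
    (hadd : ∀ f g, p f → p g → p (f + g)) (hterm : ∀ a r, p (term q a r)) : p f :=
  Finsupp.induction_linear (motive := p) f h0 hadd hterm

theorem mulLin_term (a b : Fin n →₀ ℕ) (r s : k) :
    mulLin q (term q a r) (term q b s) = term q (a + b) (r * s * C q a b) := by
  simp only [mulLin, linLift_term, LinearMap.toSpanSingleton_apply, LinearMap.smul_apply,
    ← map_smul, smul_eq_mul]
  congr 1
  ring

instance : Mul (SkewPoly q) := ⟨fun f g => mulLin q f g⟩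

instance : One (SkewPoly q) := ⟨monomial q 0⟩

theorem mul_def (f g : SkewPoly q) : f * g = mulLin q f g := rfl

theorem one_def : (1 : SkewPoly q) = term q 0 1 := rfl

theorem term_mul_term (a b : Fin n →₀ ℕ) (r s : k) :
    term q a r * term q b s = term q (a + b) (r * s * C q a b) := mulLin_term q a b r s

instance : Ring (SkewPoly q) :=
  { (inferInstance : AddCommGroup (SkewPoly q)) with
    mul := (· * ·)
    one := 1
    left_distrib := fun f g h => by simp only [mul_def, map_add]
    right_distrib := fun f g h => by simp only [mul_def, map_add, LinearMap.add_apply]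
    zero_mul := fun f => by simp only [mul_def, map_zero, LinearMap.zero_apply]
    mul_zero := fun f => by simp only [mul_def, map_zero]
    mul_assoc := fun f g h => by
      simp only [mul_def]
      induction f using induction_term with
      | h0 => simp
      | hadd f f' hf hf' => simp only [map_add, LinearMap.add_apply, hf, hf']
      | hterm a r =>
        induction g using induction_term with
        | h0 => simp
        | hadd f f' hf hf' => simp only [map_add, LinearMap.add_apply, hf, hf']
        | hterm b s =>
          induction h using induction_term with
          | h0 => simp
          | hadd f f' hf hf' => simp only [map_add, hf, hf']
          | hterm c t =>
            simp only [mulLin_term, C_add_left, C_add_right, add_assoc, Units.val_mul]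
            congr 1
            ring
    one_mul := fun f => by
      simp only [mul_def, one_def]
      induction f using induction_term with
      | h0 => simp
      | hadd f f' hf hf' => simp only [map_add, hf, hf']
      | hterm a r => simp [mulLin_term, C_zero_left]
    mul_one := fun f => by
      simp only [mul_def, one_def]
      induction f using induction_term with
      | h0 => simp
      | hadd f f' hf hf' => simp only [map_add, LinearMap.add_apply, hf, hf']
      | hterm a r => simp [mulLin_term, C_zero_right] }

instance : Algebra k (SkewPoly q) :=
  Algebra.ofModule (fun r f g => by simp only [mul_def, map_smul, LinearMap.smul_apply])
    (fun r f g => by simp only [mul_def, map_smul])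

theorem monomial_mul_monomial (a b : Fin n →₀ ℕ) :
    monomial q a * monomial q b = (C q a b : k) • monomial q (a + b) := by
  simp only [monomial, term_mul_term, ← map_smul, smul_eq_mul, one_mul, mul_one]

theorem X_mul_X (hq : ∀ i, q i i = 1) (hq' : ∀ i j, q j i = (q i j)⁻¹) (i j : Fin n) :
    X q i * X q j = (q i j : k) • (X q j * X q i) := by
  simp only [X, monomial_mul_monomial, C_single, smul_smul, add_comm (Finsupp.single j 1)]
  congr 1
  rcases lt_trichotomy i j with h | rfl | h
  · simp [h, h.not_gt, hq' i j]
  · simp [hq]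
  · simp [h, h.not_gt]

theorem X_pow (i : Fin n) (m : ℕ) : X q i ^ m = monomial q (Finsupp.single i m) := by
  induction m with
  | zero => simp [monomial, one_def]
  | succ m ih =>
    rw [pow_succ, ih, X, monomial_mul_monomial, C_eq_one, ← Finsupp.single_add]
    · simp
    · intro i' hi' j hj
      have h1 := Finsupp.support_single_subset hi'
      have h2 := Finsupp.support_single_subset hj
      simp only [Finset.mem_singleton] at h1 h2
      rw [h1, h2]

/-- The monomial `x^a` is the ordered product `x_1^{a_1} ⋯ x_n^{a_n}`. -/
theorem monomial_eq_prod (a : Fin n →₀ ℕ) :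
    monomial q a = ((List.finRange n).map fun i => X q i ^ a i).prod := by
  have key : ∀ l : List (Fin n), l.Pairwise (· < ·) →
      (l.map fun i => X q i ^ a i).prod
        = monomial q (l.map fun i => Finsupp.single i (a i)).sum := by
    intro l hl
    induction l with
    | nil => rfl
    | cons i l ih =>
      rw [List.pairwise_cons] at hl
      rw [List.map_cons, List.prod_cons, ih hl.2, X_pow, monomial_mul_monomial, C_eq_one,
        List.map_cons, List.sum_cons]
      · simp
      · intro i' hi' j hj
        have h1 := Finsupp.support_single_subset hi'
        simp only [Finset.mem_singleton] at h1
        subst h1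
        by_contra hlt
        have : ∀ l' : List (Fin n), (∀ b ∈ l', i' < b) →
            (l'.map fun i => Finsupp.single i (a i)).sum j = 0 := by
          intro l' hl'
          induction l' with
          | nil => rfl
          | cons b l' ih' =>
            have hb : b ≠ j := by
              rintro rfl
              exact hlt (hl' b (by simp)).le
            simp [hb,
              ih' fun c hc => hl' c (List.mem_cons_of_mem _ hc)]
        exact (Finsupp.mem_support_iff.1 hj) (this l hl.1)
  rw [key _ (List.pairwise_lt_finRange n)]
  congr 1
  rw [← List.ofFn_eq_map, List.sum_ofFn]
  exact (Finsupp.univ_sum_single a).symm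

/-! ### Normalizing automorphisms and the grading group -/

/-- The character `x^a ↦ ∏ t_j^{a_j}` of the monoid of monomials. -/
def diagChar (t : Fin n → kˣ) (a : Fin n →₀ ℕ) : kˣ := ∏ j, t j ^ a j

theorem diagChar_add (t : Fin n → kˣ) (a b : Fin n →₀ ℕ) : diagChar t (a + b) = diagChar t a * diagChar t b := by
  simp only [diagChar, Finsupp.add_apply, pow_add, Finset.prod_mul_distrib]

/-- The `k`-linear map `x^a ↦ (∏ t_j^{a_j}) x^a`. -/
def diagLin (t : Fin n → kˣ) : SkewPoly q →ₗ[k] SkewPoly q :=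
  linLift q fun a => (diagChar t a : k) • term q a

theorem diagLin_term (t : Fin n → kˣ) (a : Fin n →₀ ℕ) (r : k) :
    diagLin q t (term q a r) = term q a (diagChar t a * r) := by
  rw [diagLin, linLift_term, LinearMap.smul_apply, ← map_smul, smul_eq_mul]

theorem diagLin_comp_inv (t s : Fin n → kˣ) (h : ∀ j, t j * s j = 1) (f : SkewPoly q) :
    diagLin q t (diagLin q s f) = f := by
  induction f using induction_term with
  | h0 => simp
  | hadd f g hf hg => simp only [map_add, hf, hg]
  | hterm a r =>
    have : diagChar t a * diagChar s a = 1 := by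
      simp only [diagChar, ← Finset.prod_mul_distrib, ← mul_pow, h, one_pow, Finset.prod_const_one]
    rw [diagLin_term, diagLin_term, ← mul_assoc, ← Units.val_mul, this, Units.val_one, one_mul]

/-- The `k`-algebra automorphism with `x_j ↦ t_j x_j` for all `j`. -/
def diag (t : Fin n → kˣ) : SkewPoly q ≃ₐ[k] SkewPoly q :=
  AlgEquiv.ofLinearEquiv
    { diagLin q t with
      invFun := diagLin q fun j => (t j)⁻¹
      left_inv := diagLin_comp_inv q _ _ fun j => by simp
      right_inv := diagLin_comp_inv q _ _ fun j => by simp }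
    (by
      change diagLin q t (term q 0 1) = term q 0 1
      simp [diagLin_term, diagChar])
    (by
      intro f g
      change diagLin q t (f * g) = diagLin q t f * diagLin q t g
      simp only [mul_def]
      induction f using induction_term with
      | h0 => simp
      | hadd f f' hf hf' => simp only [map_add, LinearMap.add_apply, hf, hf']
      | hterm a r =>
        induction g using induction_term with
        | h0 => simp
        | hadd f f' hf hf' => simp only [map_add, hf, hf']
        | hterm b s =>
          simp only [mulLin_term, diagLin_term, diagChar_add, Units.val_mul]
          congr 1
          ring)

/-- The normalizing automorphism `σ_i` of `x_i`, given by `σ_i(x_j) = q_{ij} x_j`. -/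
def normAut (i : Fin n) : SkewPoly q ≃ₐ[k] SkewPoly q := diag q (q i)

theorem X_mul (hq : ∀ i, q i i = 1) (hq' : ∀ i j, q j i = (q i j)⁻¹) (i : Fin n)
    (f : SkewPoly q) : X q i * f = normAut q i f * X q i := by
  have key : ∀ a : Fin n →₀ ℕ,
      C q (Finsupp.single i 1) a = diagChar (q i) a * C q a (Finsupp.single i 1) := by
    intro a
    induction a using Finsupp.induction_linear with
    | zero => simp [C_zero_left, C_zero_right, diagChar]
    | add a b ha hb => rw [C_add_left, C_add_right, diagChar_add, ha, hb, mul_mul_mul_comm]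
    | single j m =>
      induction m with
      | zero => simp [C_zero_left, C_zero_right, diagChar]
      | succ m ih =>
        rw [Finsupp.single_add, C_add_left, C_add_right, diagChar_add, ih, mul_mul_mul_comm]
        congr 1
        have hc : diagChar (q i) (Finsupp.single j 1) = q i j := by
          unfold diagChar
          rw [Finset.prod_eq_single j]
          · simp
          · intro b _ hb
            simp [hb.symm]
          · simp
        rw [hc, C_single, C_single]
        rcases lt_trichotomy i j with h | rfl | h
        · simp [h, h.not_gt, hq' i j]
        · simp [hq]
        · simp [h, h.not_gt]
  change X q i * f = diagLin q (q i) f * X q i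
  induction f using induction_term with
  | h0 => simp
  | hadd f g hf hg => rw [mul_add, map_add, add_mul, hf, hg]
  | hterm a r =>
    rw [diagLin_term, X, monomial, term_mul_term, term_mul_term, key, add_comm]
    congr 1
    push_cast
    ring

/-- The group `G` generated by the normalizing automorphisms `σ_1, …, σ_n`. -/
def gradingGroup : Subgroup (SkewPoly q ≃ₐ[k] SkewPoly q) :=
  Subgroup.closure (Set.range (normAut q))

/-- The `G`-degree `σ_1^{a_1} ⋯ σ_n^{a_n}` of `x^a`. -/
def gDeg (a : Fin n →₀ ℕ) : gradingGroup q :=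
  ((List.finRange n).map fun i =>
    (⟨normAut q i, Subgroup.subset_closure ⟨i, rfl⟩⟩ : gradingGroup q) ^ a i).prod

/-- The `ℤ`-degree `∑ a_i w_i` of `x^a`, where `x_i` has degree `w_i`. -/
def zDeg (w : Fin n → ℤ) (a : Fin n →₀ ℕ) : ℤ := ∑ i, (a i : ℤ) * w i

/-- `f` lies in the component of degree `(z, g)` of the shift of `R` whose generator `1` has the
degree of the monomial `x^b`. -/
def IsHomogeneousShift (w : Fin n → ℤ) (b : Fin n →₀ ℕ) (z : ℤ) (g : gradingGroup q)
    (f : SkewPoly q) : Prop :=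
  ∀ a ∈ (coeffs q f).support, zDeg w b + zDeg w a = z ∧ gDeg q b * gDeg q a = g

end SkewPoly

/-! ## Stable ideals -/

open SkewPoly

section Ideals

variable {n : ℕ} {k : Type*} [CommRing k] {q : Fin n → Fin n → kˣ}

/-- `I` is generated by monomials. -/
def IsMonomialIdeal (I : TwoSidedIdeal (SkewPoly q)) : Prop :=
  ∃ S : Set (Fin n →₀ ℕ), I = TwoSidedIdeal.span (monomial q '' S)

/-- `I` is a monomial ideal, and for every monomial `w ∈ I` and every index `i < max(w)`, the
monomial `(x_i * w) / x_{max(w)}` lies in `I`. -/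
def IsStable (I : TwoSidedIdeal (SkewPoly q)) : Prop :=
  IsMonomialIdeal I ∧ ∀ w : Fin n →₀ ℕ, monomial q w ∈ I →
    ∀ m : Fin n, w.support.max = (m : WithBot (Fin n)) → ∀ i < m,
      monomial q (Finsupp.single i 1 + w - Finsupp.single m 1) ∈ I

/-- The canonical generator system `G(I)`: the monomials of `I` that are not a proper multiple of
another monomial of `I`. -/
def canonicalGens (I : TwoSidedIdeal (SkewPoly q)) : Set (Fin n →₀ ℕ) :=
  {u | monomial q u ∈ I ∧ ∀ v, monomial q v ∈ I → v ≤ u → v = u}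

/-- `w = u * y` is a canonical decomposition: `u ∈ G(I)` and `max(u) ≤ min(y)`. -/
def IsCanonicalDecomp (I : TwoSidedIdeal (SkewPoly q)) (w u y : Fin n →₀ ℕ) : Prop :=
  u ∈ canonicalGens I ∧ w = u + y ∧ ∀ i ∈ u.support, ∀ j ∈ y.support, i ≤ j

open Classical in
/-- The decomposition function `g`: if `w = u * y` is the canonical decomposition of `w`, then
`g(w) = u` (and `g(w) = w` for a `w` without one). -/
def decomp (I : TwoSidedIdeal (SkewPoly q)) (w : Fin n →₀ ℕ) : Fin n →₀ ℕ :=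
  if h : ∃ u y, IsCanonicalDecomp I w u y then h.choose else w

/-! ## The skew Eliahou–Kervaire complex

Right `R`-modules are modules over `Rᵐᵒᵖ`. -/

/-- `e(i_1, …, i_p; u)` is admissible: `u ∈ G(I)` and `i_1 < ⋯ < i_p < max(u)`. -/
def IsAdmissible (I : TwoSidedIdeal (SkewPoly q)) {p : ℕ} (σ : Fin p ↪o Fin n)
    (u : Fin n →₀ ℕ) : Prop :=
  u ∈ canonicalGens I ∧ ∀ r, (σ r : WithBot (Fin n)) < u.support.max

/-- The admissible symbols `e(i_1, …, i_p; u)`. -/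
@[ext]
structure AdmSymbol (I : TwoSidedIdeal (SkewPoly q)) (p : ℕ) where
  /-- the sequence `i_1 < ⋯ < i_p` -/
  seq : Fin p ↪o Fin n
  /-- the generator `u` -/
  gen : Fin n →₀ ℕ
  adm : IsAdmissible I seq gen

/-- `L_p(I)`: the free right `R`-module on the admissible symbols `e(i_1, …, i_p; u)`. -/
abbrev L (I : TwoSidedIdeal (SkewPoly q)) (p : ℕ) : Type _ := AdmSymbol I p →₀ SkewPoly q

/-- The basis of `L_p(I)` that consists of the admissible symbols. -/
def symbolBasis (I : TwoSidedIdeal (SkewPoly q)) (p : ℕ) :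
    Module.Basis (AdmSymbol I p) (SkewPoly q)ᵐᵒᵖ (L I p) :=
  Module.Basis.ofRepr (Finsupp.mapRange.linearEquiv
    { MulOpposite.opAddEquiv with
      map_smul' := fun _ _ => rfl })

theorem symbolBasis_apply (I : TwoSidedIdeal (SkewPoly q)) (p : ℕ) (s : AdmSymbol I p) :
    symbolBasis I p s = Finsupp.single s 1 := by
  simp [symbolBasis]

/-- `σ_r`: the sequence `σ` without its `r`-th term. -/
def removeTerm {p : ℕ} (σ : Fin (p + 1) ↪o Fin n) (r : Fin (p + 1)) : Fin p ↪o Fin n :=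
  (Fin.succAboveOrderEmb r).trans σ

/-- `x_σ = x_{i_1} * ⋯ * x_{i_p}`. -/
def seqMon {p : ℕ} (σ : Fin p ↪o Fin n) : Fin n →₀ ℕ := ∑ r, Finsupp.single (σ r) 1

/-- `e(σ_r; u)`, which is admissible as `e(σ; u)` is. -/
def AdmSymbol.remove {I : TwoSidedIdeal (SkewPoly q)} {p : ℕ} (s : AdmSymbol I (p + 1))
    (r : Fin (p + 1)) : AdmSymbol I p :=
  ⟨removeTerm s.seq r, s.gen, s.adm.1, fun _ => s.adm.2 _⟩

/-- `u_r = g(x_{i_r} * u)`. -/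
def AdmSymbol.genAt {I : TwoSidedIdeal (SkewPoly q)} {p : ℕ} (s : AdmSymbol I p)
    (r : Fin p) : Fin n →₀ ℕ :=
  decomp I (Finsupp.single (s.seq r) 1 + s.gen)

/-- `y_r`, the monomial with `x_{i_r} * u = u_r * y_r`. -/
def AdmSymbol.quotAt {I : TwoSidedIdeal (SkewPoly q)} {p : ℕ} (s : AdmSymbol I p)
    (r : Fin p) : Fin n →₀ ℕ :=
  Finsupp.single (s.seq r) 1 + s.gen - s.genAt r

open Classical in
/-- The value of the differential on a basis element,
`d(e(σ; u)) = ∑_r (-1)^r e(σ_r; u) C(x_{σ_r} * u, x_{i_r})⁻¹ x_{i_r}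
  - ∑_{r ∈ A(σ; u)} (-1)^r e(σ_r; u_r) C(x_{σ_r}, y_r)⁻¹ y_r`,
where `A(σ; u)` is the set of the `r` such that `e(σ_r; u_r)` is admissible. The position `r` is
counted from `1` in this formula and from `0` in `Fin (p + 1)`. -/
def dSymbol (I : TwoSidedIdeal (SkewPoly q)) (p : ℕ) (s : AdmSymbol I (p + 1)) : L I p :=
  ∑ r : Fin (p + 1), Finsupp.single (s.remove r)
      ((-1 : SkewPoly q) ^ ((r : ℕ) + 1) *
        term q (Finsupp.single (s.seq r) 1)
          ↑(C q (seqMon (removeTerm s.seq r) + s.gen) (Finsupp.single (s.seq r) 1))⁻¹)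
  - ∑ r : Fin (p + 1),
      if h : IsAdmissible I (removeTerm s.seq r) (s.genAt r) then
        Finsupp.single (⟨removeTerm s.seq r, s.genAt r, h⟩ : AdmSymbol I p)
          ((-1 : SkewPoly q) ^ ((r : ℕ) + 1) *
            term q (s.quotAt r) ↑(C q (seqMon (removeTerm s.seq r)) (s.quotAt r))⁻¹)
      else 0

/-- The differential `d : L_{p+1}(I) → L_p(I)`. -/
def d (I : TwoSidedIdeal (SkewPoly q)) (p : ℕ) : L I (p + 1) →ₗ[(SkewPoly q)ᵐᵒᵖ] L I p :=
  (symbolBasis I (p + 1)).constr ℕ (dSymbol I p)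

/-- The augmentation `L_0(I) → I`, `e(∅; u) ↦ u`. -/
def augmentation (I : TwoSidedIdeal (SkewPoly q)) : L I 0 →ₗ[(SkewPoly q)ᵐᵒᵖ] I :=
  (symbolBasis I 0).constr ℕ fun s => ⟨monomial q s.gen, s.adm.1.1⟩

/-- The component of degree `(z, g)` of `L_p(I)`, where `e(σ; u)` has the degree of `x_σ * u`. -/
def IsHomogeneousL (I : TwoSidedIdeal (SkewPoly q)) (p : ℕ) (w : Fin n → ℤ) (z : ℤ)
    (g : gradingGroup q) (f : L I p) : Prop :=
  ∀ s, IsHomogeneousShift q w (seqMon s.seq + s.gen) z g (f s)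

end Ideals

/-! ## Free resolutions -/

/-- `⋯ → F_1 → F_0 → M → 0` is a free resolution of the right `R`-module `M`: the right
`R`-modules `F_p` are free of finite rank, and the sequence is exact. -/
structure IsFreeResolution {R : Type*} [Ring R] {M : Type*} [AddCommGroup M] [Module Rᵐᵒᵖ M]
    (F : ℕ → Type*) [∀ p, AddCommGroup (F p)] [∀ p, Module Rᵐᵒᵖ (F p)]
    (δ : ∀ p, F (p + 1) →ₗ[Rᵐᵒᵖ] F p) (ε : F 0 →ₗ[Rᵐᵒᵖ] M) : Prop where
  free : ∀ p, Module.Free Rᵐᵒᵖ (F p)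
  finite : ∀ p, Module.Finite Rᵐᵒᵖ (F p)
  surjective : Function.Surjective ε
  exact_zero : Function.Exact (δ 0) ε
  exact_succ : ∀ p, Function.Exact (δ (p + 1)) (δ p)

/-- The submodule `M J` of a right `R`-module `M`, generated by the `v c` with `v ∈ M`, `c ∈ J`. -/
def mulIdeal {R : Type*} [Ring R] (J : TwoSidedIdeal R) (M : Type*) [AddCommGroup M]
    [Module Rᵐᵒᵖ M] : Submodule Rᵐᵒᵖ M :=
  Submodule.span Rᵐᵒᵖ {y | ∃ v : M, ∃ c ∈ J, y = MulOpposite.op c • v}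

/-- The complex `F` of right `R`-modules is minimal: `δ(F_{p+1}) ⊆ F_p (x_1, …, x_n)`. -/
def IsMinimal {n : ℕ} {k : Type*} [CommRing k] (q : Fin n → Fin n → kˣ)
    (F : ℕ → Type*) [∀ p, AddCommGroup (F p)] [∀ p, Module (SkewPoly q)ᵐᵒᵖ (F p)]
    (δ : ∀ p, F (p + 1) →ₗ[(SkewPoly q)ᵐᵒᵖ] F p) : Prop :=
  ∀ p, LinearMap.range (δ p) ≤ mulIdeal (TwoSidedIdeal.span (Set.range (X q))) (F p)

end SkewEK

end

noncomputable section

namespace SkewEK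

open SkewPoly

/-! ### Supports and maxima of monomials -/

section Monomials

variable {n : ℕ}

/-! The scalars are removed first. A multiple `e(σ; u) x^b` is normalized by the factor `C(x_σ * u,
x^b)⁻¹` (`symTerm`) and labelled by its total degree `a = x_σ * u * x^b` (`cell`). As `C` is a
bicharacter and `max(u_r) ≤ min(y_r)`, the differential becomes `∑ ± (cell(σ_r, u, a) - cell(σ_r,
u_r, a))`, as over a commutative polynomial ring (`d_cell`). Then `d² = 0` is the simplicial sign
cancellation together with `g(x_i * g(x_j * u)) = g(x_j * g(x_i * u))` (`IsStable.decomp_comm`).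

Exactness is a normal form argument. A term `e(σ; u) * x^b` is reduced if every variable `x_i` of
`x^b` with `i < max(u)` satisfies `i_1 ≤ i`. Two facts suffice.

Every element is reduced modulo the image of `d` (`exists_sub_d_mem_reducedSubgroup`). If the least
variable `x_j` of `x^b` violates the condition, the boundary of the term with `j` moved to the front
of `σ` replaces `u` by `g(x_j * u)`, up to reduced terms. This generator is lexicographically
larger, and it divides the fixed monomial `a`, so the process stops.

On reduced elements `d` and the augmentation are injective (`eq_zero_of_d_eq_zero`,
`eq_zero_of_augmentation_eq_zero`). For `d`, among the terms with lexicographically least `u`, the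
leading part `e(σ_1; u) * (x_{i_1} * x^b)` determines the reduced term. For the augmentation,
reduced terms are exactly canonical decompositions, which are unique.

So the reduced remainder of a cycle is a reduced cycle, hence zero, and the cycle is a boundary. The
total degree `a` is preserved throughout, which gives every coarser grading. Minimality holds
because `y_r ≠ 1`. -/

theorem coe_lt_support_max_iff {u : Fin n →₀ ℕ} {i : Fin n} :
    (i : WithBot (Fin n)) < u.support.max ↔ ∃ m ∈ u.support, i < m := by
  simp [Finset.max, Finset.lt_sup_iff]

theorem exists_support_max {w : Fin n →₀ ℕ} (hw : w ≠ 0) :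
    ∃ m : Fin n, w.support.max = (m : WithBot (Fin n)) ∧ m ∈ w.support ∧ ∀ i ∈ w.support, i ≤ m := by
  obtain ⟨m, hm⟩ := Finset.max_of_nonempty (Finsupp.support_nonempty_iff.2 hw)
  exact ⟨m, hm, Finset.mem_of_max hm, fun i hi => Finset.le_max_of_eq hi hm⟩

end Monomials

/-! ### Monomial ideals and the decomposition function of a stable ideal -/

section Decomposition

variable {n : ℕ} {k : Type*} [CommRing k] {q : Fin n → Fin n → kˣ}
  {I : TwoSidedIdeal (SkewPoly q)}

theorem coeffs_term (a : Fin n →₀ ℕ) (c : k) :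
    coeffs q (term q a c) = Finsupp.single a c := by
  simp [term]

theorem sum_term (f : SkewPoly q) : ((coeffs q f).sum fun a c => term q a c) = f := by
  apply (coeffs q).injective
  simp only [Finsupp.sum, map_sum, coeffs_term]
  exact Finsupp.sum_single (coeffs q f)

theorem term_mem_of_le {u w : Fin n →₀ ℕ} (hu : monomial q u ∈ I) (h : u ≤ w) (c : k) :
    term q w c ∈ I := by
  have := I.mul_mem_right _ (term q (w - u) (c * ↑(C q u (w - u))⁻¹)) hu
  rwa [monomial, term_mul_term, add_tsub_cancel_of_le h, one_mul, mul_assoc, Units.inv_mul,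
    mul_one] at this

theorem monomial_mem_of_le {u w : Fin n →₀ ℕ} (hu : monomial q u ∈ I) (h : u ≤ w) :
    monomial q w ∈ I := term_mem_of_le hu h 1

theorem coeffs_mul_support {f g : SkewPoly q} {a : Fin n →₀ ℕ}
    (ha : a ∈ (coeffs q (f * g)).support) :
    ∃ b ∈ (coeffs q f).support, ∃ c ∈ (coeffs q g).support, a = b + c := by
  by_contra! hcon
  refine Finsupp.mem_support_iff.1 ha ?_
  conv_lhs => rw [← sum_term f, ← sum_term g]
  simp only [Finsupp.sum, Finset.sum_mul_sum, map_sum, term_mul_term, coeffs_term,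
    Finsupp.coe_finsetSum, Finset.sum_apply]
  exact Finset.sum_eq_zero fun b hb => Finset.sum_eq_zero fun c hc =>
    Finsupp.single_eq_of_ne (hcon b hb c hc)

/-- The elements all of whose monomials are divisible by a member of `S` form a two-sided ideal that
contains the generators, hence all of `I`. -/
theorem IsMonomialIdeal.monomial_mem_of_mem_support (hI : IsMonomialIdeal I) {f : SkewPoly q}
    (hf : f ∈ I) {a : Fin n →₀ ℕ} (ha : a ∈ (coeffs q f).support) : monomial q a ∈ I := by
  obtain ⟨S, rfl⟩ := hI
  suffices ∃ s ∈ S, s ≤ a by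
    obtain ⟨s, hs, hsa⟩ := this
    exact monomial_mem_of_le (TwoSidedIdeal.subset_span ⟨s, hs, rfl⟩) hsa
  revert a
  let J : TwoSidedIdeal (SkewPoly q) := TwoSidedIdeal.mk'
    {f | ∀ a ∈ (coeffs q f).support, ∃ s ∈ S, s ≤ a}
    (by simp)
    (by
      intro f g hf hg a ha
      rw [map_add] at ha
      rcases Finset.mem_union.1 (Finsupp.support_add ha) with h | h
      exacts [hf a h, hg a h])
    (by
      intro f hf a ha
      rw [map_neg, Finsupp.support_neg] at ha
      exact hf a ha)
    (by
      intro f g hg a ha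
      obtain ⟨b, -, c, hc, rfl⟩ := coeffs_mul_support ha
      obtain ⟨s, hs, hsc⟩ := hg c hc
      exact ⟨s, hs, hsc.trans le_add_self⟩)
    (by
      intro f g hf a ha
      obtain ⟨b, hb, c, -, rfl⟩ := coeffs_mul_support ha
      obtain ⟨s, hs, hsb⟩ := hf b hb
      exact ⟨s, hs, hsb.trans le_self_add⟩)
  have hJ : TwoSidedIdeal.span (monomial q '' S) ≤ J := by
    rw [TwoSidedIdeal.span_le]
    rintro _ ⟨s, hs, rfl⟩
    simp only [J, SetLike.mem_coe, TwoSidedIdeal.mem_mk', Set.mem_ofPred_eq]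
    intro a ha
    rw [monomial, coeffs_term] at ha
    obtain rfl := Finset.mem_singleton.1 (Finsupp.support_single_subset ha)
    exact ⟨a, hs, le_rfl⟩
  have := hJ hf
  simpa only [J, TwoSidedIdeal.mem_mk', Set.mem_ofPred_eq] using this

/-- Dickson's lemma: minimal generators are pairwise incomparable for divisibility. -/
theorem canonicalGens_finite (I : TwoSidedIdeal (SkewPoly q)) : (canonicalGens I).Finite := by
  have hanti : IsAntichain (· ≤ ·) (canonicalGens I) := fun u hu v hv huv hle =>
    huv (hv.2 u hu.1 hle)
  exact WellQuasiOrderedLE.finite_of_isAntichain hanti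

/-- If `w` is not a minimal generator, then `w / x_{max(w)}` still lies in `I`; its canonical
decomposition is extended by the factor `x_{max(w)}`. -/
theorem IsStable.exists_isCanonicalDecomp (hI : IsStable I) (w : Fin n →₀ ℕ)
    (hw : monomial q w ∈ I) : ∃ u y, IsCanonicalDecomp I w u y := by
  induction hN : w.degree generalizing w with
  | zero =>
    obtain rfl : w = 0 := (Finsupp.degree_eq_zero_iff w).1 hN
    exact ⟨0, 0, ⟨hw, fun v _ h => le_antisymm h (zero_le)⟩, by simp, by simp⟩
  | succ N ih =>
    by_cases hG : w ∈ canonicalGens I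
    · exact ⟨w, 0, hG, by simp, by simp⟩
    · obtain ⟨v, hv, hvw, hne⟩ : ∃ v, monomial q v ∈ I ∧ v ≤ w ∧ v ≠ w := by
        by_contra! h
        exact hG ⟨hw, h⟩
      have hw0 : w ≠ 0 := by rintro rfl; simp at hN
      obtain ⟨m, hm, hmw, hmax⟩ := exists_support_max hw0
      have hm1 : 1 ≤ w m := Nat.one_le_iff_ne_zero.2 (Finsupp.mem_support_iff.1 hmw)
      have hwm : w = (w - Finsupp.single m 1) + Finsupp.single m 1 :=
        (tsub_add_cancel_of_le (by simpa using hm1)).symm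
      have key : monomial q (w - Finsupp.single m 1) ∈ I := by
        by_cases hvm : v m < w m
        · refine monomial_mem_of_le hv fun i => ?_
          have := hvw i
          by_cases hi : i = m
          · subst hi; simp; omega
          · simpa [Finsupp.single_eq_of_ne hi]
        · have hvm' : v m = w m := le_antisymm (hvw m) (not_lt.1 hvm)
          obtain ⟨i, hi⟩ : ∃ i, v i ≠ w i := by
            by_contra! h
            exact hne (Finsupp.ext h)
          have hi' : v i < w i := lt_of_le_of_ne (hvw i) hi
          have him : i < m := lt_of_le_of_ne (hmax i (by simp; omega)) fun h => hi (h ▸ hvm')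
          have hvmax : v.support.max = (m : WithBot (Fin n)) := by
            refine le_antisymm ?_ (Finset.le_max (by simp; omega))
            rw [← hm]
            exact Finset.max_mono fun j hj => by
              have := hvw j
              simp at hj ⊢
              omega
          -- The proper divisor `v` has the full power of `x_m`, so `w / x_m` need not be a multiple
          -- of `v`. Stability trades one `x_m` in `v` for an `x_i` of which `w` has more than `v`.
          refine monomial_mem_of_le (hI.2 v hv m hvmax i him) fun j => ?_
          have := hvw j
          simp only [Finsupp.coe_tsub, Finsupp.coe_add, Pi.sub_apply, Pi.add_apply,
            Finsupp.single_apply]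
          split_ifs <;> subst_vars <;> omega
      obtain ⟨u, y, hu, hy, huy⟩ := ih _ key (by
        have := congrArg Finsupp.degree hwm
        rw [map_add, Finsupp.degree_single] at this
        omega)
      refine ⟨u, y + Finsupp.single m 1, hu, by rw [← add_assoc, ← hy, ← hwm], ?_⟩
      intro i hi j hj
      rcases Finset.mem_union.1 (Finsupp.support_add hj) with h | h
      · exact huy i hi j h
      · obtain rfl := Finset.mem_singleton.1 (Finsupp.support_single_subset h)
        refine hmax i ?_
        have := DFunLike.congr_fun hy i
        simp at this hi ⊢
        omega

/-- If `u` exceeds `u'` at `i` and `u'` exceeds `u` at `j`, then `x_i` occurs in `y'` and `x_j` in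
`u'`, so `j ≤ i`; by symmetry `i = j`, which is absurd. Hence one generator divides the other, and
minimality gives equality. -/
theorem IsCanonicalDecomp.gen_unique {w u y u' y' : Fin n →₀ ℕ} (h : IsCanonicalDecomp I w u y)
    (h' : IsCanonicalDecomp I w u' y') : u = u' := by
  have aux : ∀ {u y u' y' : Fin n →₀ ℕ} {i j : Fin n}, IsCanonicalDecomp I w u y →
      IsCanonicalDecomp I w u' y' → u' i < u i → u j < u' j → j ≤ i := by
    intro u y u' y' i j h h' hi hj
    refine h'.2.2 j (by simp; omega) i ?_
    have h1 := DFunLike.congr_fun h.2.1 i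
    have h2 := DFunLike.congr_fun h'.2.1 i
    simp at h1 h2 ⊢
    omega
  by_cases hle : u ≤ u'
  · exact h'.1.2 u h.1.1 hle
  · by_cases hle' : u' ≤ u
    · exact (h.1.2 u' h'.1.1 hle').symm
    · simp only [Finsupp.le_def, not_forall, not_le] at hle hle'
      obtain ⟨i, hi⟩ := hle
      obtain ⟨j, hj⟩ := hle'
      obtain rfl := le_antisymm (aux h' h hj hi) (aux h h' hi hj)
      omega

theorem IsCanonicalDecomp.decomp_eq {w u y : Fin n →₀ ℕ} (h : IsCanonicalDecomp I w u y) :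
    decomp I w = u := by
  have hex : ∃ u y, IsCanonicalDecomp I w u y := ⟨u, y, h⟩
  rw [decomp, dif_pos hex]
  exact hex.choose_spec.choose_spec.gen_unique h

theorem IsStable.isCanonicalDecomp_decomp (hI : IsStable I) {w : Fin n →₀ ℕ}
    (hw : monomial q w ∈ I) : IsCanonicalDecomp I w (decomp I w) (w - decomp I w) := by
  obtain ⟨u, y, h⟩ := hI.exists_isCanonicalDecomp w hw
  rw [h.decomp_eq]
  convert h using 1
  rw [h.2.1, add_tsub_cancel_left]

theorem decomp_single_add_of_forall_le {u : Fin n →₀ ℕ} (hu : u ∈ canonicalGens I) {i : Fin n}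
    (hi : ∀ j ∈ u.support, j ≤ i) : decomp I (Finsupp.single i 1 + u) = u := by
  refine IsCanonicalDecomp.decomp_eq (y := Finsupp.single i 1) ⟨hu, add_comm _ _, ?_⟩
  intro j hj j' hj'
  obtain rfl := Finset.mem_singleton.1 (Finsupp.support_single_subset hj')
  exact hi j hj

/-- With `w = u * y` and `x_i * u = v * z` canonical, `v * (z * y)` is canonical for `x_i * w`. The
only variable of `v` possibly missing from `u` is `x_i`: if `i < max(u)` it precedes `y`, and
otherwise `v = u`. -/
theorem IsStable.decomp_single_add_decomp (hI : IsStable I) {w : Fin n →₀ ℕ}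
    (hw : monomial q w ∈ I) (i : Fin n) :
    decomp I (Finsupp.single i 1 + decomp I w) = decomp I (Finsupp.single i 1 + w) := by
  have hd := hI.isCanonicalDecomp_decomp hw
  have hd' := hI.isCanonicalDecomp_decomp (monomial_mem_of_le hd.1.1
    (le_add_self : _ ≤ Finsupp.single i 1 + decomp I w))
  symm
  set u := decomp I w
  set v := decomp I (Finsupp.single i 1 + u)
  set y := w - u
  set z := Finsupp.single i 1 + u - v
  refine IsCanonicalDecomp.decomp_eq (y := z + y) ⟨hd'.1, ?_, ?_⟩
  · rw [← add_assoc, ← hd'.2.1, add_assoc, ← hd.2.1]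
  · intro j hj j' hj'
    rcases Finset.mem_union.1 (Finsupp.support_add hj') with h | h
    · exact hd'.2.2 j hj j' h
    · by_cases hi : ∀ l ∈ u.support, l ≤ i
      · have hvu : v = u := decomp_single_add_of_forall_le hd.1 hi
        exact hd.2.2 j (hvu ▸ hj) j' h
      · push Not at hi
        obtain ⟨l, hl, hil⟩ := hi
        have h1 := DFunLike.congr_fun hd'.2.1 j
        by_cases hju : j ∈ u.support
        · exact hd.2.2 j hju j' h
        · have hji : j = i := by
            by_contra hne
            simp [Finsupp.single_eq_of_ne hne] at h1 hj hju
            omega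
          exact (hji ▸ hil.le).trans (hd.2.2 l hl j' h)

theorem IsStable.decomp_comm (hI : IsStable I) {u : Fin n →₀ ℕ} (hu : monomial q u ∈ I)
    (i j : Fin n) :
    decomp I (Finsupp.single i 1 + decomp I (Finsupp.single j 1 + u)) =
      decomp I (Finsupp.single j 1 + decomp I (Finsupp.single i 1 + u)) := by
  rw [hI.decomp_single_add_decomp (monomial_mem_of_le hu le_add_self),
    hI.decomp_single_add_decomp (monomial_mem_of_le hu le_add_self), add_left_comm]

/-- The generator `v = g(x_j * u)` cannot divide `u`: it would equal `u` and leave the quotient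
`x_j` with `j < max(u)`. So `v` absorbs the new `x_j`, and the quotient involves no variable before
`x_j`. -/
theorem IsStable.decomp_apply_of_lt (hI : IsStable I) {u : Fin n →₀ ℕ}
    (hu : u ∈ canonicalGens I) {j m : Fin n} (hm : m ∈ u.support) (hj : j < m) :
    (∀ i < j, decomp I (Finsupp.single j 1 + u) i = u i) ∧
      decomp I (Finsupp.single j 1 + u) j = u j + 1 := by
  have hd := hI.isCanonicalDecomp_decomp (monomial_mem_of_le hu.1
    (le_add_self : _ ≤ Finsupp.single j 1 + u))
  set v := decomp I (Finsupp.single j 1 + u)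
  set y := Finsupp.single j 1 + u - v
  have hsum : ∀ i, Finsupp.single j 1 i + u i = v i + y i := fun i => DFunLike.congr_fun hd.2.1 i
  have hvu : ¬ v ≤ u := fun h => by
    have hvu : v = u := hu.2 v hd.1.1 h
    have h1 : y = Finsupp.single j 1 := by
      refine Finsupp.ext fun i => ?_
      have := hsum i
      rw [hvu] at this
      omega
    exact hj.not_ge (hd.2.2 m (hvu ▸ hm) j (by simp [h1]))
  have hvj : u j < v j := by
    by_contra hlt
    refine hvu fun i => ?_
    by_cases hi : i = j
    · subst hi; omega
    · have := hsum i
      rw [Finsupp.single_eq_of_ne hi] at this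
      omega
  refine ⟨fun i hi => ?_, ?_⟩
  · have h1 : y i = 0 := by
      by_contra hne
      exact hi.not_ge (hd.2.2 j (by simp; omega) i (by simpa using hne))
    have := hsum i
    rw [Finsupp.single_eq_of_ne hi.ne] at this
    omega
  · have := hsum j
    rw [Finsupp.single_eq_same] at this
    omega

/-- This order serves twice: it makes the reduction process terminate, and it singles out the
leading terms of `d`. -/
theorem IsStable.toLex_lt_toLex_decomp (hI : IsStable I) {u : Fin n →₀ ℕ}
    (hu : u ∈ canonicalGens I) {j m : Fin n} (hm : m ∈ u.support) (hj : j < m) :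
    toLex u < toLex (decomp I (Finsupp.single j 1 + u)) := by
  obtain ⟨h1, h2⟩ := hI.decomp_apply_of_lt hu hm hj
  exact ⟨j, fun i hi => (h1 i hi).symm, by
    change u j < decomp I (Finsupp.single j 1 + u) j
    omega⟩

theorem IsStable.decomp_mem (hI : IsStable I) {u : Fin n →₀ ℕ} (hu : u ∈ canonicalGens I)
    (j : Fin n) : decomp I (Finsupp.single j 1 + u) ∈ canonicalGens I :=
  (hI.isCanonicalDecomp_decomp (monomial_mem_of_le hu.1 le_add_self)).1

theorem IsStable.decomp_le (hI : IsStable I) {u : Fin n →₀ ℕ} (hu : u ∈ canonicalGens I)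
    (j : Fin n) : decomp I (Finsupp.single j 1 + u) ≤ Finsupp.single j 1 + u := by
  conv_rhs => rw [(hI.isCanonicalDecomp_decomp (monomial_mem_of_le hu.1 le_add_self)).2.1]
  exact le_self_add

/-- The support of `g(x_j * u)` lies in that of `x_j * u`. -/
theorem IsStable.mem_support_decomp (hI : IsStable I) {u : Fin n →₀ ℕ}
    (hu : u ∈ canonicalGens I) {i j : Fin n}
    (hi : i ∈ (decomp I (Finsupp.single j 1 + u)).support) : i = j ∨ i ∈ u.support := by
  have := hI.decomp_le hu j i
  by_cases hij : i = j
  · exact Or.inl hij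
  · right
    rw [Finsupp.add_apply, Finsupp.single_eq_of_ne hij] at this
    simp at hi ⊢
    omega

end Decomposition

/-! ### The differential without scalars, `d² = 0`, and the augmentation -/

section Differential

/-- Deleting two terms in either order is a fixed-point-free involution of the pairs `(r, s)` that
reverses the sign. -/
theorem sum_sum_neg_one_pow_smul_eq_zero {A : Type*} [AddCommGroup A] {p : ℕ}
    (f : Fin (p + 2) → Fin (p + 1) → A)
    (hf : ∀ r s, f (r.succAbove s) (s.predAbove r) = f r s) :
    ∑ r : Fin (p + 2), ∑ s : Fin (p + 1), (-1 : ℤ) ^ ((r : ℕ) + (s : ℕ)) • f r s = 0 := by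
  rw [← Finset.sum_product' Finset.univ Finset.univ
    (fun (r : Fin (p + 2)) (s : Fin (p + 1)) => (-1 : ℤ) ^ ((r : ℕ) + (s : ℕ)) • f r s)]
  refine Finset.sum_involution (fun x _ => (x.1.succAbove x.2, x.2.predAbove x.1)) ?_ ?_ ?_ ?_
  · rintro ⟨r, s⟩ -
    simp only [hf, Fin.neg_one_pow_succAbove_add_predAbove, neg_smul, add_neg_cancel]
  · rintro ⟨r, s⟩ - - h
    exact Fin.succAbove_ne r s (congrArg Prod.fst h)
  · simp
  · rintro ⟨r, s⟩ -
    simp only [Fin.succAbove_succAbove_predAbove, Fin.predAbove_predAbove_succAbove]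

variable {n : ℕ}

theorem removeTerm_apply {p : ℕ} (σ : Fin (p + 1) ↪o Fin n) (r : Fin (p + 1)) (i : Fin p) :
    removeTerm σ r i = σ (r.succAbove i) := rfl

theorem removeTerm_removeTerm {p : ℕ} (σ : Fin (p + 2) ↪o Fin n) (r : Fin (p + 2))
    (s : Fin (p + 1)) :
    removeTerm (removeTerm σ (r.succAbove s)) (s.predAbove r) = removeTerm (removeTerm σ r) s := by
  ext i
  simp only [removeTerm_apply, Fin.succAbove_succAbove_succAbove_predAbove]

theorem seqMon_eq_add_removeTerm {p : ℕ} (σ : Fin (p + 1) ↪o Fin n) (r : Fin (p + 1)) :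
    seqMon σ = Finsupp.single (σ r) 1 + seqMon (removeTerm σ r) :=
  Fin.sum_univ_succAbove _ r

variable {k : Type*} [CommRing k] {q : Fin n → Fin n → kˣ} {I : TwoSidedIdeal (SkewPoly q)}

/-- The cocycle identity `C(m, y) C(m * y, b) = C(m, y * b) C(y, b)`: normalized coefficients
multiply without a scalar. -/
theorem term_mul_term_inv_C (m y b : Fin n →₀ ℕ) (c : k) :
    term q y ↑(C q m y)⁻¹ * term q b (c * ↑(C q (m + y) b)⁻¹) =
      term q (y + b) (c * ↑(C q m (y + b))⁻¹) := by
  rw [term_mul_term, C_add_left, C_add_right]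
  congr 1
  have h : (C q m y)⁻¹ * (C q m b * C q y b)⁻¹ * C q y b = (C q m y * C q m b)⁻¹ := by
    rw [mul_inv, mul_inv, mul_assoc, mul_assoc, inv_mul_cancel, mul_one]
  rw [← h]
  push_cast
  ring

/-- The term `e(σ; u) * x^b` with coefficient `c`, that is `e(σ; u) C(x_σ * u, x^b)⁻¹ c x^b`. -/
def symTerm {p : ℕ} (s : AdmSymbol I p) (b : Fin n →₀ ℕ) (c : k) : L I p :=
  Finsupp.single s (term q b (c * ↑(C q (seqMon s.seq + s.gen) b)⁻¹))

open Classical in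
/-- The term `e(σ; u) * y` of total degree `a` with coefficient `c`, or zero if `e(σ; u)` is not
admissible. -/
def cell (I : TwoSidedIdeal (SkewPoly q)) {p : ℕ} (σ : Fin p ↪o Fin n) (u a : Fin n →₀ ℕ)
    (c : k) : L I p :=
  if h : IsAdmissible I σ u then symTerm ⟨σ, u, h⟩ (a - (seqMon σ + u)) c else 0

theorem cell_of_isAdmissible {p : ℕ} {σ : Fin p ↪o Fin n} {u : Fin n →₀ ℕ}
    (h : IsAdmissible I σ u) (a : Fin n →₀ ℕ) (c : k) :
    cell I σ u a c = symTerm ⟨σ, u, h⟩ (a - (seqMon σ + u)) c := dif_pos h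

theorem cell_of_not_isAdmissible {p : ℕ} {σ : Fin p ↪o Fin n} {u : Fin n →₀ ℕ}
    (h : ¬ IsAdmissible I σ u) (a : Fin n →₀ ℕ) (c : k) : cell I σ u a c = 0 := dif_neg h

theorem symTerm_eq_cell {p : ℕ} (s : AdmSymbol I p) (b : Fin n →₀ ℕ) (c : k) :
    symTerm s b c = cell I s.seq s.gen (seqMon s.seq + s.gen + b) c := by
  rw [cell_of_isAdmissible s.adm, add_tsub_cancel_left]

theorem single_eq_smul_symbolBasis {p : ℕ} (s : AdmSymbol I p) (f : SkewPoly q) :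
    (Finsupp.single s f : L I p) = MulOpposite.op f • symbolBasis I p s := by
  rw [symbolBasis_apply, Finsupp.smul_single, op_smul_eq_mul, one_mul]

theorem op_smul_single_neg_one_pow_mul {p : ℕ} (s : AdmSymbol I p) (m : ℕ) (f g : SkewPoly q) :
    MulOpposite.op g • (Finsupp.single s ((-1) ^ m * f) : L I p) =
      (-1 : ℤ) ^ m • Finsupp.single s (f * g) := by
  rw [Finsupp.smul_single, op_smul_eq_mul, Finsupp.smul_single, mul_assoc,
    zsmul_eq_mul]
  push_cast
  rfl

theorem AdmSymbol.genAt_add_quotAt (hI : IsStable I) {p : ℕ} (s : AdmSymbol I p) (r : Fin p) :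
    IsCanonicalDecomp I (Finsupp.single (s.seq r) 1 + s.gen) (s.genAt r) (s.quotAt r) :=
  hI.isCanonicalDecomp_decomp (monomial_mem_of_le s.adm.1.1 le_add_self)

theorem d_single {p : ℕ} (s : AdmSymbol I (p + 1)) (f : SkewPoly q) :
    d I p (Finsupp.single s f) = MulOpposite.op f • dSymbol I p s := by
  rw [single_eq_smul_symbolBasis, map_smul, d, Module.Basis.constr_basis]

theorem d_symTerm (hI : IsStable I) {p : ℕ} (s : AdmSymbol I (p + 1)) (b : Fin n →₀ ℕ) (c : k) :
    d I p (symTerm s b c) = ∑ r : Fin (p + 1), (-1 : ℤ) ^ ((r : ℕ) + 1) •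
      (cell I (removeTerm s.seq r) s.gen (seqMon s.seq + s.gen + b) c -
        cell I (removeTerm s.seq r) (s.genAt r) (seqMon s.seq + s.gen + b) c) := by
  simp only [smul_sub]
  rw [symTerm, d_single, dSymbol, smul_sub, Finset.smul_sum, Finset.smul_sum,
    Finset.sum_sub_distrib]
  congr 1
  · refine Finset.sum_congr rfl fun r _ => ?_
    have hs : seqMon s.seq + s.gen =
        (seqMon (removeTerm s.seq r) + s.gen) + Finsupp.single (s.seq r) 1 := by
      rw [seqMon_eq_add_removeTerm s.seq r]; abel
    rw [op_smul_single_neg_one_pow_mul, hs, term_mul_term_inv_C,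
      cell_of_isAdmissible (show IsAdmissible I (removeTerm s.seq r) s.gen from (s.remove r).adm),
      add_assoc _ (Finsupp.single _ _) b,
      add_tsub_cancel_left]
    rfl
  · refine Finset.sum_congr rfl fun r _ => ?_
    split_ifs with h
    · have hd := s.genAt_add_quotAt hI r
      have hs : seqMon s.seq + s.gen =
          (seqMon (removeTerm s.seq r) + s.genAt r) + s.quotAt r := by
        rw [seqMon_eq_add_removeTerm s.seq r, add_assoc _ (s.genAt r), ← hd.2.1]; abel
      -- The scalar in `d` omits `u_r`, which is harmless: `C(u_r, y_r) = 1` because `max(u_r) ≤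
      -- min(y_r)`.
      have hC : C q (seqMon (removeTerm s.seq r)) (s.quotAt r) =
          C q (seqMon (removeTerm s.seq r) + s.genAt r) (s.quotAt r) := by
        rw [C_add_left, C_eq_one q _ _ hd.2.2, mul_one]
      rw [op_smul_single_neg_one_pow_mul, hs, hC, term_mul_term_inv_C, cell_of_isAdmissible h,
        add_assoc _ (s.quotAt r) b, add_tsub_cancel_left]
      rfl
    · rw [cell_of_not_isAdmissible h, smul_zero, smul_zero]

theorem not_isAdmissible_iff {p : ℕ} {σ : Fin (p + 1) ↪o Fin n} {u : Fin n →₀ ℕ}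
    (hu : u ∈ canonicalGens I) :
    ¬ IsAdmissible I σ u ↔ ∀ j ∈ u.support, j ≤ σ (Fin.last p) := by
  simp only [IsAdmissible, hu, true_and, coe_lt_support_max_iff, not_forall, not_exists, not_and,
    not_lt]
  exact ⟨fun ⟨r, hr⟩ j hj => (hr j hj).trans (σ.monotone (Fin.le_last r)), fun h => ⟨_, h⟩⟩

theorem not_isAdmissible_of_forall_le {p : ℕ} {σ : Fin p ↪o Fin n} {u : Fin n →₀ ℕ} (r : Fin p)
    (h : ∀ j ∈ u.support, j ≤ σ r) : ¬ IsAdmissible I σ u := fun hadm => by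
  obtain ⟨m, hm, hlt⟩ := coe_lt_support_max_iff.1 (hadm.2 r)
  exact hlt.not_ge (h m hm)

/-- The formula also holds for inadmissible symbols, so `d` can be iterated without case
distinctions. If `max(u) ≤ i_p` for the last term `i_p` of `σ`, the two cells for the last position
cancel since `g(x_{i_p} * u) = u`; at every other position `i_p` survives and both cells vanish. -/
theorem d_cell (hI : IsStable I) {p : ℕ} {σ : Fin (p + 1) ↪o Fin n} {u a : Fin n →₀ ℕ}
    (hu : u ∈ canonicalGens I) (ha : seqMon σ + u ≤ a) (c : k) :
    d I p (cell I σ u a c) = ∑ r : Fin (p + 1), (-1 : ℤ) ^ ((r : ℕ) + 1) •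
      (cell I (removeTerm σ r) u a c -
        cell I (removeTerm σ r) (decomp I (Finsupp.single (σ r) 1 + u)) a c) := by
  by_cases h : IsAdmissible I σ u
  · rw [cell_of_isAdmissible h, d_symTerm hI]
    dsimp only [AdmSymbol.genAt]
    rw [add_tsub_cancel_of_le ha]
  · rw [cell_of_not_isAdmissible h, map_zero]
    rw [not_isAdmissible_iff hu] at h
    symm
    refine Finset.sum_eq_zero fun r _ => ?_
    by_cases hr : r = Fin.last p
    · rw [hr, decomp_single_add_of_forall_le hu h, sub_self, smul_zero]
    · obtain ⟨l, hl⟩ := Fin.exists_succAbove_eq (Ne.symm hr)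
      rw [cell_of_not_isAdmissible, cell_of_not_isAdmissible, sub_self, smul_zero]
      · refine not_isAdmissible_of_forall_le l fun j hj => ?_
        rw [removeTerm_apply, hl]
        rcases hI.mem_support_decomp hu hj with rfl | hj
        · exact σ.monotone (Fin.le_last r)
        · exact h j hj
      · refine not_isAdmissible_of_forall_le l fun j hj => ?_
        rw [removeTerm_apply, hl]
        exact h j hj

theorem seqMon_removeTerm_add_le {p : ℕ} {σ : Fin (p + 1) ↪o Fin n} {u a : Fin n →₀ ℕ}
    (ha : seqMon σ + u ≤ a) (r : Fin (p + 1)) : seqMon (removeTerm σ r) + u ≤ a := by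
  rw [seqMon_eq_add_removeTerm σ r, add_assoc] at ha
  exact le_add_self.trans ha

theorem IsStable.seqMon_removeTerm_add_decomp_le (hI : IsStable I) {p : ℕ}
    {σ : Fin (p + 1) ↪o Fin n} {u a : Fin n →₀ ℕ} (hu : u ∈ canonicalGens I)
    (ha : seqMon σ + u ≤ a) (r : Fin (p + 1)) :
    seqMon (removeTerm σ r) + decomp I (Finsupp.single (σ r) 1 + u) ≤ a := by
  refine ((add_le_add le_rfl (hI.decomp_le hu (σ r))).trans_eq ?_).trans ha
  rw [seqMon_eq_add_removeTerm σ r]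
  abel

theorem d_d_cell (hI : IsStable I) {p : ℕ} {σ : Fin (p + 2) ↪o Fin n} {u a : Fin n →₀ ℕ}
    (hu : u ∈ canonicalGens I) (ha : seqMon σ + u ≤ a) (c : k) :
    d I p (d I (p + 1) (cell I σ u a c)) = 0 := by
  rw [d_cell hI hu ha, map_sum]
  have hterm : ∀ r : Fin (p + 2), d I p ((-1 : ℤ) ^ ((r : ℕ) + 1) •
      (cell I (removeTerm σ r) u a c -
        cell I (removeTerm σ r) (decomp I (Finsupp.single (σ r) 1 + u)) a c)) =
      ∑ s : Fin (p + 1), (-1 : ℤ) ^ ((r : ℕ) + (s : ℕ)) •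
        ((cell I (removeTerm (removeTerm σ r) s) u a c -
          cell I (removeTerm (removeTerm σ r) s)
            (decomp I (Finsupp.single (σ (r.succAbove s)) 1 + u)) a c) -
        (cell I (removeTerm (removeTerm σ r) s)
          (decomp I (Finsupp.single (σ r) 1 + u)) a c -
          cell I (removeTerm (removeTerm σ r) s) (decomp I (Finsupp.single (σ (r.succAbove s)) 1 +
            decomp I (Finsupp.single (σ r) 1 + u))) a c)) := by
    intro r
    rw [map_zsmul, map_sub, d_cell hI hu (seqMon_removeTerm_add_le ha r),
      d_cell hI (hI.decomp_mem hu _) (hI.seqMon_removeTerm_add_decomp_le hu ha r),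
      ← Finset.sum_sub_distrib, Finset.smul_sum]
    refine Finset.sum_congr rfl fun s _ => ?_
    rw [← smul_sub, smul_smul, removeTerm_apply]
    congr 1
    ring
  rw [Finset.sum_congr rfl fun r _ => hterm r]
  -- Exchanging the two deletions swaps the two mixed cells and fixes the other two, the last one by
  -- `decomp_comm`.
  refine sum_sum_neg_one_pow_smul_eq_zero _ fun r s => ?_
  rw [removeTerm_removeTerm, Fin.succAbove_succAbove_predAbove, hI.decomp_comm hu.1]
  abel

/-- An additive property of elements of `L_p(I)` that holds for all terms holds everywhere. -/
theorem L_induction {p : ℕ} {P : L I p → Prop} (f : L I p) (h0 : P 0)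
    (hadd : ∀ f g, P f → P g → P (f + g)) (hterm : ∀ s b c, P (symTerm s b c)) : P f := by
  induction f using Finsupp.induction_linear with
  | zero => exact h0
  | add f g hf hg => exact hadd f g hf hg
  | single s x =>
    induction x using induction_term with
    | h0 => simpa using h0
    | hadd x y hx hy => rw [Finsupp.single_add]; exact hadd _ _ hx hy
    | hterm b c =>
      have := hterm s b (c * ↑(C q (seqMon s.seq + s.gen) b))
      rwa [symTerm, mul_assoc, Units.mul_inv, mul_one] at this

theorem d_d (hI : IsStable I) (p : ℕ) (f : L I (p + 2)) : d I p (d I (p + 1) f) = 0 := by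
  induction f using L_induction with
  | h0 => simp
  | hadd f g hf hg => rw [map_add, map_add, hf, hg, add_zero]
  | hterm s b c => rw [symTerm_eq_cell, d_d_cell hI s.adm.1 le_self_add]

theorem augmentation_symTerm (s : AdmSymbol I 0) (b : Fin n →₀ ℕ) (c : k) :
    (augmentation I (symTerm s b c) : SkewPoly q) = term q (s.gen + b) c := by
  rw [symTerm, single_eq_smul_symbolBasis, map_smul, augmentation, Module.Basis.constr_basis]
  change monomial q s.gen * term q b _ = _
  rw [monomial, term_mul_term, one_mul, mul_assoc]
  simp [seqMon]

theorem augmentation_cell {σ : Fin 0 ↪o Fin n} {u a : Fin n →₀ ℕ}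
    (hu : u ∈ canonicalGens I) (ha : u ≤ a) (c : k) :
    (augmentation I (cell I σ u a c) : SkewPoly q) = term q a c := by
  rw [cell_of_isAdmissible ⟨hu, fun r => r.elim0⟩, augmentation_symTerm]
  simp [seqMon, add_tsub_cancel_of_le ha]

theorem augmentation_d (hI : IsStable I) (f : L I 1) : augmentation I (d I 0 f) = 0 := by
  induction f using L_induction with
  | h0 => simp
  | hadd f g hf hg => rw [map_add, map_add, hf, hg, add_zero]
  | hterm s b c =>
    have ha : seqMon s.seq + s.gen ≤ seqMon s.seq + s.gen + b := le_self_add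
    have h1 := seqMon_removeTerm_add_le ha 0
    have h2 := hI.seqMon_removeTerm_add_decomp_le s.adm.1 ha 0
    apply Subtype.ext
    rw [symTerm_eq_cell, d_cell hI s.adm.1 ha, Fin.sum_univ_one, map_zsmul, map_sub]
    have : (augmentation I (cell I (removeTerm s.seq 0) s.gen (seqMon s.seq + s.gen + b) c)) =
        augmentation I (cell I (removeTerm s.seq 0)
          (decomp I (Finsupp.single (s.seq 0) 1 + s.gen)) (seqMon s.seq + s.gen + b) c) := by
      apply Subtype.ext
      rw [augmentation_cell s.adm.1 (le_add_self.trans h1),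
        augmentation_cell (hI.decomp_mem s.adm.1 _) (le_add_self.trans h2)]
    rw [this, sub_self, smul_zero]

theorem augmentation_surjective (hI : IsStable I) : Function.Surjective (augmentation I) := by
  rintro ⟨f, hf⟩
  have hex : ∀ a ∈ (coeffs q f).support, ∃ g : L I 0,
      (augmentation I g : SkewPoly q) = term q a (coeffs q f a) := fun a ha => by
    have hd := hI.isCanonicalDecomp_decomp (hI.1.monomial_mem_of_mem_support hf ha)
    exact ⟨_, augmentation_cell (σ := OrderEmbedding.ofIsEmpty) hd.1
      (by conv_rhs => rw [hd.2.1]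
          exact le_self_add) _⟩
  choose! g hg using hex
  refine ⟨∑ a ∈ (coeffs q f).support, g a, Subtype.ext ?_⟩
  refine Eq.trans ?_ (sum_term f)
  rw [map_sum]
  have : ∀ (S : Finset (Fin n →₀ ℕ)) (h : (Fin n →₀ ℕ) → I),
      ((∑ a ∈ S, h a : I) : SkewPoly q) = ∑ a ∈ S, (h a : SkewPoly q) := by
    classical
    intro S h
    induction S using Finset.induction_on with
    | empty => rfl
    | insert a S ha ih => rw [Finset.sum_insert ha, Finset.sum_insert ha, ← ih]; rfl
  rw [this]
  exact Finset.sum_congr rfl hg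

end Differential

/-! ### Reduced terms and exactness -/

section Exactness

variable {n : ℕ} {k : Type*} [CommRing k] {q : Fin n → Fin n → kˣ} {I : TwoSidedIdeal (SkewPoly q)}

/-- `f(s, b)` with `f = ∑ e(σ; u) * x^b f(s, b)`, where `s = e(σ; u)`. -/
def symCoeff {p : ℕ} (s : AdmSymbol I p) (b : Fin n →₀ ℕ) : L I p →+ k where
  toFun f := coeffs q (f s) b * C q (seqMon s.seq + s.gen) b
  map_zero' := by simp
  map_add' f g := by simp [add_mul]

theorem symCoeff_symTerm_self {p : ℕ} (s : AdmSymbol I p) (b : Fin n →₀ ℕ) (c : k) :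
    symCoeff s b (symTerm s b c) = c := by
  simp [symCoeff, symTerm, coeffs_term, mul_assoc]

theorem symCoeff_symTerm_of_ne {p : ℕ} {s s' : AdmSymbol I p} {b b' : Fin n →₀ ℕ}
    (h : ¬ (s' = s ∧ b' = b)) (c : k) : symCoeff s b (symTerm s' b' c) = 0 := by
  simp only [symCoeff, symTerm, AddMonoidHom.coe_mk, ZeroHom.coe_mk]
  by_cases hs : s' = s
  · subst hs
    rw [Finsupp.single_eq_same, coeffs_term,
      Finsupp.single_eq_of_ne (fun hb => h ⟨rfl, hb.symm⟩), zero_mul]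
  · rw [Finsupp.single_eq_of_ne (Ne.symm hs), map_zero, Finsupp.zero_apply, zero_mul]

theorem symCoeff_cell_of_ne {p : ℕ} {s : AdmSymbol I p} {b : Fin n →₀ ℕ} {σ : Fin p ↪o Fin n}
    {u a : Fin n →₀ ℕ} (h : ¬ (σ = s.seq ∧ u = s.gen ∧ a - (seqMon σ + u) = b)) (c : k) :
    symCoeff s b (cell I σ u a c) = 0 := by
  by_cases hadm : IsAdmissible I σ u
  · rw [cell_of_isAdmissible hadm]
    refine symCoeff_symTerm_of_ne (fun hs => h ?_) c
    obtain ⟨rfl, rfl⟩ := hs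
    exact ⟨rfl, rfl, rfl⟩
  · rw [cell_of_not_isAdmissible hadm, map_zero]

theorem sum_symTerm {p : ℕ} (f : L I p) :
    ∑ s ∈ f.support, ∑ b ∈ (coeffs q (f s)).support, symTerm s b (symCoeff s b f) = f := by
  refine Eq.trans (Finset.sum_congr rfl fun s _ => ?_) (Finsupp.sum_single f)
  conv_rhs => rw [← sum_term (f s)]
  rw [Finsupp.sum, ← Finsupp.singleAddHom_apply, map_sum]
  refine Finset.sum_congr rfl fun b _ => ?_
  simp [symTerm, symCoeff, mul_assoc]

/-- `e(σ; u) * x^b` is reduced if no variable `x_i` of `x^b` with `i < max(u)` precedes the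
sequence `σ`. -/
def IsReduced {p : ℕ} (s : AdmSymbol I p) (b : Fin n →₀ ℕ) : Prop :=
  ∀ i ∈ b.support, (i : WithBot (Fin n)) < s.gen.support.max → ∃ r, s.seq r ≤ i

/-- The elements of `L_p(I)` all of whose terms are reduced. -/
def reducedSubgroup (I : TwoSidedIdeal (SkewPoly q)) (p : ℕ) : AddSubgroup (L I p) where
  carrier := {f | ∀ s b, symCoeff s b f ≠ 0 → IsReduced s b}
  zero_mem' s b h := absurd (map_zero _) h
  add_mem' {f g} hf hg s b h := by
    by_cases h0 : symCoeff s b f = 0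
    · exact hg s b fun h1 => h (by rw [map_add, h0, h1, add_zero])
    · exact hf s b h0
  neg_mem' {f} hf s b h := hf s b fun h0 => h (by rw [map_neg, h0, neg_zero])

theorem symTerm_mem_reducedSubgroup {p : ℕ} {s : AdmSymbol I p} {b : Fin n →₀ ℕ}
    (h : IsReduced s b) (c : k) : symTerm s b c ∈ reducedSubgroup I p := by
  intro s' b' hne
  obtain ⟨rfl, rfl⟩ := not_imp_comm.1 (fun h => symCoeff_symTerm_of_ne h c) hne
  exact h

theorem cell_mem_reducedSubgroup {p : ℕ} {σ : Fin p ↪o Fin n} {u a : Fin n →₀ ℕ}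
    (h : ∀ i ∈ (a - (seqMon σ + u)).support, (i : WithBot (Fin n)) < u.support.max →
      ∃ r, σ r ≤ i) (c : k) : cell I σ u a c ∈ reducedSubgroup I p := by
  by_cases hadm : IsAdmissible I σ u
  · rw [cell_of_isAdmissible hadm]
    exact symTerm_mem_reducedSubgroup (s := ⟨σ, u, hadm⟩) h c
  · rw [cell_of_not_isAdmissible hadm]
    exact zero_mem _

/-- The sequence `(j, i_1, …, i_p)`. -/
def consSeq {p : ℕ} (j : Fin n) (σ : Fin p ↪o Fin n) (h : ∀ r, j < σ r) : Fin (p + 1) ↪o Fin n :=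
  OrderEmbedding.ofStrictMono (Fin.cons j σ) (Fin.strictMono_cons.2 ⟨h, σ.strictMono⟩)

theorem consSeq_zero {p : ℕ} (j : Fin n) (σ : Fin p ↪o Fin n) (h : ∀ r, j < σ r) :
    consSeq j σ h 0 = j := rfl

theorem consSeq_succ {p : ℕ} (j : Fin n) (σ : Fin p ↪o Fin n) (h : ∀ r, j < σ r) (r : Fin p) :
    consSeq j σ h r.succ = σ r := rfl

theorem removeTerm_consSeq_zero {p : ℕ} (j : Fin n) (σ : Fin p ↪o Fin n) (h : ∀ r, j < σ r) :
    removeTerm (consSeq j σ h) 0 = σ := by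
  ext i
  rw [removeTerm_apply, Fin.zero_succAbove, consSeq_succ]

theorem removeTerm_succ_zero {p : ℕ} (σ : Fin (p + 2) ↪o Fin n) (r : Fin (p + 1)) :
    removeTerm σ r.succ 0 = σ 0 := by
  rw [removeTerm_apply, Fin.succAbove_ne_zero_zero (Fin.succ_ne_zero r)]

/-- The sequence still begins with `j`, and since `v` agrees with `u` below `j`, the cofactor has no
variable before `x_j`. -/
theorem cell_removeTerm_consSeq_succ_mem {p : ℕ} {σ : Fin p ↪o Fin n} {u v a : Fin n →₀ ℕ}
    {j : Fin n} (hj : ∀ r, j < σ r) (ha : seqMon σ + u ≤ a)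
    (hmin : ∀ i < j, (a - (seqMon σ + u)) i = 0) (hv : ∀ i < j, v i = u i) (c : k) (r : Fin p) :
    cell I (removeTerm (consSeq j σ hj) r.succ) v a c ∈ reducedSubgroup I p := by
  refine cell_mem_reducedSubgroup (fun i hi _ => ?_) c
  obtain _ | p := p
  · exact r.elim0
  refine ⟨0, ?_⟩
  rw [removeTerm_succ_zero, consSeq_zero]
  by_contra! hij
  have h1 := DFunLike.congr_fun (seqMon_eq_add_removeTerm (consSeq j σ hj) 0) i
  have h2 := DFunLike.congr_fun (seqMon_eq_add_removeTerm (consSeq j σ hj) r.succ) i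
  rw [removeTerm_consSeq_zero, consSeq_zero, Finsupp.add_apply,
    Finsupp.single_eq_of_ne hij.ne] at h1
  rw [consSeq_succ, Finsupp.add_apply, Finsupp.single_eq_of_ne (hij.trans (hj r)).ne] at h2
  have h3 := hmin i hij
  have h4 := hv i hij
  simp only [Finsupp.mem_support_iff, Finsupp.coe_tsub, Finsupp.coe_add, Pi.sub_apply,
    Pi.add_apply] at hi h3
  omega

theorem exists_cell_sub_d_mem_reducedSubgroup (hI : IsStable I) {p : ℕ} (σ : Fin p ↪o Fin n)
    (a : Fin n →₀ ℕ) (c : k) {u : Fin n →₀ ℕ} (hua : u ≤ a) (hu : u ∈ canonicalGens I)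
    (ha : seqMon σ + u ≤ a) :
    ∃ g : L I (p + 1), cell I σ u a c - d I p g ∈ reducedSubgroup I p := by
  -- The induction runs towards lexicographically larger generators; it is well founded because `a`
  -- has finitely many divisors.
  have hwf : (Set.Iic a).WellFoundedOn fun u v : Fin n →₀ ℕ => toLex v < toLex u :=
    have : IsStrictOrder (Fin n →₀ ℕ) fun u v => toLex v < toLex u :=
      { irrefl := fun u => lt_irrefl (toLex u)
        trans := fun _ _ _ h h' => lt_trans h' h }
    (Set.finite_Iic a).wellFoundedOn
  refine hwf.induction (P := fun u => u ∈ canonicalGens I → seqMon σ + u ≤ a →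
    ∃ g : L I (p + 1), cell I σ u a c - d I p g ∈ reducedSubgroup I p) hua ?_ hu ha
  clear hua hu ha u
  intro u _ ih hu ha
  by_cases hadm : IsAdmissible I σ u
  swap
  · exact ⟨0, by rw [cell_of_not_isAdmissible hadm, map_zero, sub_zero]; exact zero_mem _⟩
  by_cases hred : ∀ i ∈ (a - (seqMon σ + u)).support, (i : WithBot (Fin n)) < u.support.max →
      ∃ r, σ r ≤ i
  · exact ⟨0, by rw [map_zero, sub_zero]; exact cell_mem_reducedSubgroup hred c⟩
  push Not at hred
  obtain ⟨i, hi, hiu, hiσ⟩ := hred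
  obtain ⟨m, hm, him⟩ := coe_lt_support_max_iff.1 hiu
  -- The least variable of the cofactor also precedes `σ` and `max(u)`; minimality makes the other
  -- boundary terms reduced.
  obtain ⟨j, hj, hjmin⟩ := (a - (seqMon σ + u)).support.exists_min_image id ⟨i, hi⟩
  have hji : j ≤ i := hjmin i hi
  have hjm : j < m := hji.trans_lt him
  have hjσ : ∀ r, j < σ r := fun r => hji.trans_lt (hiσ r)
  have hmin : ∀ l < j, (a - (seqMon σ + u)) l = 0 := fun l hl => by
    by_contra hne
    exact hl.not_ge (hjmin l (by simpa using hne))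
  have hτ : seqMon (consSeq j σ hjσ) = Finsupp.single j 1 + seqMon σ := by
    rw [seqMon_eq_add_removeTerm _ 0, removeTerm_consSeq_zero, consSeq_zero]
  have haτ : seqMon (consSeq j σ hjσ) + u ≤ a := fun l => by
    have h1 := ha l
    have h2 : Finsupp.single j 1 l ≤ (a - (seqMon σ + u)) l := by
      rw [Finsupp.single_apply]
      split_ifs with h
      · subst h
        exact Nat.one_le_iff_ne_zero.2 (by simpa using hj)
      · exact Nat.zero_le _
    rw [hτ]
    simp only [Finsupp.coe_tsub, Finsupp.coe_add, Pi.sub_apply, Pi.add_apply] at h1 h2 ⊢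
    omega
  have hau' := hI.seqMon_removeTerm_add_decomp_le hu haτ 0
  rw [removeTerm_consSeq_zero, consSeq_zero] at hau'
  obtain ⟨g, hg⟩ := ih _ (le_add_self.trans hau') (hI.toLex_lt_toLex_decomp hu hm hjm)
    (hI.decomp_mem hu j) hau'
  -- Position `0` carries the sign `-1`, so adding the boundary of this cell turns the generator `u`
  -- into `g(x_j * u)`, which `g` handles.
  refine ⟨g - cell I (consSeq j σ hjσ) u a c, ?_⟩
  have hd := d_cell hI hu haτ c
  rw [Fin.sum_univ_succ, removeTerm_consSeq_zero, consSeq_zero] at hd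
  have hrest := sum_mem (t := Finset.univ) fun (r : Fin p) _ =>
    zsmul_mem (sub_mem (cell_removeTerm_consSeq_succ_mem (I := I) (v := u) hjσ ha hmin
      (fun _ _ => rfl) c r)
      (cell_removeTerm_consSeq_succ_mem (I := I) hjσ ha hmin
        (v := decomp I (Finsupp.single (σ r) 1 + u)) (fun l hl => by
          obtain ⟨m', hm', hlt⟩ := coe_lt_support_max_iff.1 (hadm.2 r)
          exact (hI.decomp_apply_of_lt hu hm' hlt).1 l (hl.trans (hjσ r))) c r))
      ((-1 : ℤ) ^ ((r.succ : ℕ) + 1))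
  simp only [consSeq_succ] at hd
  convert add_mem hg hrest using 1
  rw [map_sub, hd]
  simp only [Fin.val_zero, zero_add, pow_one, neg_smul, one_smul]
  abel

theorem exists_sub_d_mem_reducedSubgroup (hI : IsStable I) {p : ℕ} (f : L I p) :
    ∃ g : L I (p + 1), f - d I p g ∈ reducedSubgroup I p := by
  induction f using L_induction with
  | h0 => exact ⟨0, by rw [map_zero, sub_zero]; exact zero_mem _⟩
  | hadd f f' hf hf' =>
    obtain ⟨g, hg⟩ := hf
    obtain ⟨g', hg'⟩ := hf'
    exact ⟨g + g', by rw [map_add, add_sub_add_comm]; exact add_mem hg hg'⟩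
  | hterm s b c =>
    rw [symTerm_eq_cell]
    exact exists_cell_sub_d_mem_reducedSubgroup hI _ _ c
      ((le_add_self.trans le_self_add : s.gen ≤ seqMon s.seq + s.gen + b)) s.adm.1 le_self_add

/-- A triangularity criterion shared by `d` and the augmentation: for a term of `f` with
lexicographically least generator, the functional `κ` sees that term alone in `φ f`, so its
coefficient vanishes. -/
theorem eq_zero_of_leading_term {p : ℕ} {A : Type*} [AddCommGroup A] (φ : L I p →+ A)
    (h : ∀ s b, IsReduced s b → ∃ κ : A →+ k, (∀ c, κ (φ (symTerm s b c)) = 0 → c = 0) ∧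
      ∀ s' b' c, IsReduced s' b' → toLex s.gen ≤ toLex s'.gen → ¬ (s' = s ∧ b' = b) →
        κ (φ (symTerm s' b' c)) = 0)
    {f : L I p} (hf : f ∈ reducedSubgroup I p) (h0 : φ f = 0) : f = 0 := by
  by_contra hne
  obtain ⟨s, hs, hmin⟩ := f.support.exists_min_image (fun s => toLex s.gen)
    (Finsupp.support_nonempty_iff.2 hne)
  have hcoeff : ∀ {s b}, b ∈ (coeffs q (f s)).support → symCoeff s b f ≠ 0 := fun hb h0 =>
    Finsupp.mem_support_iff.1 hb ((Units.mul_left_eq_zero _).1 h0)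
  obtain ⟨b, hb⟩ : (coeffs q (f s)).support.Nonempty :=
    Finsupp.support_nonempty_iff.2 fun h0 =>
      Finsupp.mem_support_iff.1 hs ((coeffs q).map_eq_zero_iff.1 h0)
  obtain ⟨κ, hκ, hκ'⟩ := h s b (hf s b (hcoeff hb))
  refine hcoeff hb (hκ _ ?_)
  have := congrArg (κ ∘ φ) (sum_symTerm f)
  simp only [Function.comp_apply, h0, map_zero, map_sum] at this
  rwa [Finset.sum_eq_single_of_mem s hs, Finset.sum_eq_single_of_mem b hb] at this
  · exact fun b' hb' hne' => hκ' s b' _ (hf s b' (hcoeff hb')) le_rfl fun h => hne' h.2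
  · exact fun s' hs' hne' => Finset.sum_eq_zero fun b' hb' =>
      hκ' s' b' _ (hf s' b' (hcoeff hb')) (hmin s' hs') fun h => hne' h.1

theorem AdmSymbol.toLex_gen_lt_toLex_genAt (hI : IsStable I) {p : ℕ} (s : AdmSymbol I p)
    (r : Fin p) : toLex s.gen < toLex (s.genAt r) := by
  obtain ⟨m, hm, hlt⟩ := coe_lt_support_max_iff.1 (s.adm.2 r)
  exact hI.toLex_lt_toLex_decomp s.adm.1 hm hlt

/-- If the variables moved to the right differ, then `x_{i_1}` of `s` occurs in `b'`, and
reducedness bounds the first term of `s'` by `i_1`. For `r ≠ 0` that first term is the second term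
of `s`, a contradiction; for `r = 0` the bound holds both ways. -/
theorem eq_of_removeTerm_eq {p : ℕ} {s s' : AdmSymbol I (p + 1)} {b b' : Fin n →₀ ℕ}
    (hb : IsReduced s b) (hb' : IsReduced s' b') {r : Fin (p + 1)}
    (hseq : removeTerm s'.seq r = removeTerm s.seq 0) (hgen : s'.gen = s.gen)
    (hmon : Finsupp.single (s'.seq r) 1 + b' = Finsupp.single (s.seq 0) 1 + b) :
    r = 0 ∧ s' = s ∧ b' = b := by
  have aux : ∀ {s s' : AdmSymbol I (p + 1)} {b b' : Fin n →₀ ℕ} {r : Fin (p + 1)},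
      IsReduced s' b' → s'.gen = s.gen →
      Finsupp.single (s'.seq r) 1 + b' = Finsupp.single (s.seq 0) 1 + b →
      s'.seq r ≠ s.seq 0 → s'.seq 0 ≤ s.seq 0 := by
    intro s s' b b' r hb' hgen hmon hne
    have h1 := DFunLike.congr_fun hmon (s.seq 0)
    rw [Finsupp.add_apply, Finsupp.add_apply, Finsupp.single_eq_same,
      Finsupp.single_eq_of_ne hne.symm] at h1
    obtain ⟨t, ht⟩ := hb' (s.seq 0) (by simp; omega) (hgen ▸ s.adm.2 0)
    exact (s'.seq.monotone (Fin.zero_le t)).trans ht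
  have hr : r = 0 := by
    by_contra hr
    obtain ⟨r, rfl⟩ := Fin.exists_succ_eq.2 hr
    obtain _ | p := p
    · exact r.elim0
    have h0 : s'.seq 0 = s.seq 1 := by
      have := DFunLike.congr_fun hseq 0
      rwa [removeTerm_succ_zero, removeTerm_apply, Fin.zero_succAbove] at this
    have h1 : s.seq 0 < s'.seq 0 := h0 ▸ s.seq.strictMono (Fin.succ_pos 0)
    exact h1.not_ge (aux hb' hgen hmon (h1.trans (s'.seq.strictMono (Fin.succ_pos r))).ne')
  subst hr
  have h0 : s'.seq 0 = s.seq 0 := by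
    by_contra hne
    exact hne (le_antisymm (aux hb' hgen hmon hne) (aux hb hgen.symm hmon.symm (Ne.symm hne)))
  refine ⟨rfl, AdmSymbol.ext ?_ hgen, ?_⟩
  · ext i
    refine Fin.cases (by rw [h0]) (fun i => ?_) i
    have := DFunLike.congr_fun hseq i
    rw [removeTerm_apply, removeTerm_apply, Fin.zero_succAbove] at this
    rw [this]
  · rw [h0] at hmon
    exact add_left_cancel hmon

/-- The second cell has a generator strictly larger than that of `s`; the first is governed by
`eq_of_removeTerm_eq`. -/
theorem symCoeff_sub_of_ne (hI : IsStable I) {p : ℕ} {s s' : AdmSymbol I (p + 1)}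
    {b b' : Fin n →₀ ℕ} (hb : IsReduced s b) (hb' : IsReduced s' b')
    (hle : toLex s.gen ≤ toLex s'.gen) {r : Fin (p + 1)} (hne : ¬ (r = 0 ∧ s' = s ∧ b' = b))
    (c : k) :
    symCoeff (s.remove 0) (Finsupp.single (s.seq 0) 1 + b)
      (cell I (removeTerm s'.seq r) s'.gen (seqMon s'.seq + s'.gen + b') c -
        cell I (removeTerm s'.seq r) (s'.genAt r) (seqMon s'.seq + s'.gen + b') c) = 0 := by
  rw [map_sub, symCoeff_cell_of_ne (u := s'.genAt r), symCoeff_cell_of_ne, sub_zero]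
  · rintro ⟨h1, h2, h3⟩
    refine hne (eq_of_removeTerm_eq hb hb' h1 h2 (Eq.trans (Eq.symm ?_) h3))
    rw [seqMon_eq_add_removeTerm s'.seq r, tsub_eq_iff_eq_add_of_le]
    · abel
    · intro i
      simp only [Finsupp.coe_add, Pi.add_apply]
      omega
  · rintro ⟨-, h2, -⟩
    exact ((s'.toLex_gen_lt_toLex_genAt hI r).trans_le' hle).ne' (congrArg toLex h2)

theorem symCoeff_d_symTerm_self (hI : IsStable I) {p : ℕ} {s : AdmSymbol I (p + 1)}
    {b : Fin n →₀ ℕ} (hb : IsReduced s b) (c : k) :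
    symCoeff (s.remove 0) (Finsupp.single (s.seq 0) 1 + b) (d I p (symTerm s b c)) = -c := by
  rw [d_symTerm hI, map_sum, Finset.sum_eq_single_of_mem 0 (Finset.mem_univ _)]
  · have hcell : cell I (removeTerm s.seq 0) s.gen (seqMon s.seq + s.gen + b) c =
        symTerm (s.remove 0) (Finsupp.single (s.seq 0) 1 + b) c := by
      rw [symTerm_eq_cell, seqMon_eq_add_removeTerm s.seq 0]
      simp only [AdmSymbol.remove]
      congr 1
      abel
    rw [map_zsmul, map_sub, symCoeff_cell_of_ne (u := s.genAt 0), hcell, symCoeff_symTerm_self]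
    · simp
    · exact fun h => (s.toLex_gen_lt_toLex_genAt hI 0).ne' (congrArg toLex h.2.1)
  · intro r _ hr
    rw [map_zsmul, symCoeff_sub_of_ne hI hb hb le_rfl fun h => hr h.1, smul_zero]

theorem eq_zero_of_d_eq_zero (hI : IsStable I) {p : ℕ} {f : L I (p + 1)}
    (hf : f ∈ reducedSubgroup I (p + 1)) (h0 : d I p f = 0) : f = 0 := by
  refine eq_zero_of_leading_term (d I p).toAddMonoidHom (fun s b hb => ?_) hf h0
  refine ⟨symCoeff (s.remove 0) (Finsupp.single (s.seq 0) 1 + b), fun c hc => ?_,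
    fun s' b' c hb' hle hne => ?_⟩
  · rw [LinearMap.toAddMonoidHom_coe, symCoeff_d_symTerm_self hI hb] at hc
    exact neg_eq_zero.1 hc
  · rw [LinearMap.toAddMonoidHom_coe, d_symTerm hI, map_sum]
    refine Finset.sum_eq_zero fun r _ => ?_
    rw [map_zsmul, symCoeff_sub_of_ne hI hb hb' hle fun h => hne h.2, smul_zero]

/-- The coefficient of `x^a` as an additive map on the ideal `I`. -/
def idealCoeff (I : TwoSidedIdeal (SkewPoly q)) (a : Fin n →₀ ℕ) : I →+ k where
  toFun f := coeffs q (f : SkewPoly q) a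
  map_zero' := by
    change coeffs q 0 a = 0
    simp
  map_add' f g := by
    change coeffs q ((f : SkewPoly q) + g) a = _
    simp

theorem eq_zero_of_augmentation_eq_zero {f : L I 0} (hf : f ∈ reducedSubgroup I 0)
    (h0 : augmentation I f = 0) : f = 0 := by
  refine eq_zero_of_leading_term (augmentation I).toAddMonoidHom (fun s b hb => ?_) hf h0
  have hval : ∀ s' b' c, idealCoeff I (s.gen + b) (augmentation I (symTerm s' b' c)) =
      Finsupp.single (s'.gen + b') c (s.gen + b) := fun s' b' c => by
    change coeffs q (augmentation I (symTerm s' b' c) : SkewPoly q) (s.gen + b) = _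
    rw [augmentation_symTerm, coeffs_term]
  -- With an empty sequence, reducedness says that no variable of `x^b` precedes `max(u)`.
  have hdecomp : ∀ {s : AdmSymbol I 0} {b : Fin n →₀ ℕ}, IsReduced s b →
      IsCanonicalDecomp I (s.gen + b) s.gen b := fun {s b} h =>
    ⟨s.adm.1, rfl, fun i hi j hj => by
      by_contra! hlt
      exact (h j hj (coe_lt_support_max_iff.2 ⟨i, hi, hlt⟩)).choose.elim0⟩
  refine ⟨idealCoeff I (s.gen + b), fun c hc => ?_, fun s' b' c hb' _ hne => ?_⟩
  · rwa [LinearMap.toAddMonoidHom_coe, hval, Finsupp.single_eq_same] at hc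
  · rw [LinearMap.toAddMonoidHom_coe, hval]
    refine Finsupp.single_eq_of_ne fun heq => hne ?_
    have hgen := (heq ▸ hdecomp hb').gen_unique (hdecomp hb)
    refine ⟨AdmSymbol.ext (RelEmbedding.ext fun r => r.elim0) hgen, ?_⟩
    rw [hgen] at heq
    exact (add_left_cancel heq).symm

theorem exact_d_augmentation (hI : IsStable I) : Function.Exact (d I 0) (augmentation I) := by
  refine fun f => ⟨fun hf => ?_, ?_⟩
  · obtain ⟨g, hg⟩ := exists_sub_d_mem_reducedSubgroup hI f
    exact ⟨g, (sub_eq_zero.1 (eq_zero_of_augmentation_eq_zero hg (by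
      rw [map_sub, hf, augmentation_d hI, sub_zero]))).symm⟩
  · rintro ⟨g, rfl⟩
    exact augmentation_d hI g

theorem exact_d_d (hI : IsStable I) (p : ℕ) : Function.Exact (d I (p + 1)) (d I p) := by
  refine fun f => ⟨fun hf => ?_, ?_⟩
  · obtain ⟨g, hg⟩ := exists_sub_d_mem_reducedSubgroup hI f
    exact ⟨g, (sub_eq_zero.1 (eq_zero_of_d_eq_zero hI hg (by
      rw [map_sub, hf, d_d hI, sub_zero]))).symm⟩
  · rintro ⟨g, rfl⟩
    exact d_d hI p g

instance (I : TwoSidedIdeal (SkewPoly q)) (p : ℕ) : Finite (AdmSymbol I p) :=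
  have := (canonicalGens_finite I).to_subtype
  Finite.of_injective
    (fun s : AdmSymbol I p => ((s.seq, ⟨s.gen, s.adm.1⟩) : (Fin p ↪o Fin n) × canonicalGens I))
    fun _ _ h => AdmSymbol.ext (congrArg Prod.fst h)
      (congrArg Subtype.val (congrArg Prod.snd h))

theorem isFreeResolution (hI : IsStable I) :
    IsFreeResolution (R := SkewPoly q) (L I) (d I) (augmentation I) where
  free p := Module.Free.of_basis (symbolBasis I p)
  finite p := Module.Finite.of_basis (symbolBasis I p)
  surjective := augmentation_surjective hI
  exact_zero := exact_d_augmentation hI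
  exact_succ := exact_d_d hI

end Exactness

/-! ### Multidegrees and the grading -/

section Grading

variable {n : ℕ} {k : Type*} [CommRing k] {q : Fin n → Fin n → kˣ} {I : TwoSidedIdeal (SkewPoly q)}

theorem diag_mul_diag_comm (s t : Fin n → kˣ) : diag q s * diag q t = diag q t * diag q s := by
  ext f
  change diagLin q s (diagLin q t f) = diagLin q t (diagLin q s f)
  induction f using induction_term with
  | h0 => simp
  | hadd f g hf hg => simp only [map_add, hf, hg]
  | hterm a r => simp only [diagLin_term, mul_left_comm]

instance (q : Fin n → Fin n → kˣ) : IsMulCommutative (gradingGroup q) :=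
  Subgroup.isMulCommutative_closure (by
    rintro _ ⟨i, rfl⟩ _ ⟨j, rfl⟩
    exact diag_mul_diag_comm _ _)

/-- The automorphisms `σ_i` are diagonal on monomials, so `G` is commutative and the factors can be
regrouped. -/
theorem gDeg_add (a b : Fin n →₀ ℕ) : gDeg q (a + b) = gDeg q a * gDeg q b := by
  have key : ∀ (γ : Fin n → gradingGroup q) (l : List (Fin n)),
      (l.map fun i => γ i ^ (a + b) i).prod =
        (l.map fun i => γ i ^ a i).prod * (l.map fun i => γ i ^ b i).prod := by
    intro γ l
    induction l with
    | nil => simp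
    | cons i l ih =>
      rw [List.map_cons, List.prod_cons, ih, List.map_cons, List.prod_cons, List.map_cons,
        List.prod_cons, Finsupp.add_apply, pow_add, mul_assoc, mul_assoc,
        ← mul_assoc (γ i ^ b i), mul_comm' (γ i ^ b i), mul_assoc]
  exact key _ _

theorem zDeg_add (w : Fin n → ℤ) (a b : Fin n →₀ ℕ) : zDeg w (a + b) = zDeg w a + zDeg w b := by
  simp only [zDeg, Finsupp.add_apply, Nat.cast_add, add_mul, Finset.sum_add_distrib]

/-- The elements of `L_p(I)` all of whose terms have a total degree in `D`. -/
def degreeSubgroup (I : TwoSidedIdeal (SkewPoly q)) (p : ℕ) (D : Set (Fin n →₀ ℕ)) :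
    AddSubgroup (L I p) where
  carrier := {f | ∀ s b, symCoeff s b f ≠ 0 → seqMon s.seq + s.gen + b ∈ D}
  zero_mem' s b h := absurd (map_zero _) h
  add_mem' {f g} hf hg s b h := by
    by_cases h0 : symCoeff s b f = 0
    · exact hg s b fun h1 => h (by rw [map_add, h0, h1, add_zero])
    · exact hf s b h0
  neg_mem' {f} hf s b h := hf s b fun h0 => h (by rw [map_neg, h0, neg_zero])

theorem mem_support_iff_symCoeff_ne_zero {p : ℕ} {f : L I p} {s : AdmSymbol I p}
    {b : Fin n →₀ ℕ} : b ∈ (coeffs q (f s)).support ↔ symCoeff s b f ≠ 0 := by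
  rw [Finsupp.mem_support_iff]
  exact not_congr (Units.mul_left_eq_zero _).symm

theorem isHomogeneousL_iff {p : ℕ} {w : Fin n → ℤ} {z : ℤ} {g : gradingGroup q} {f : L I p} :
    IsHomogeneousL I p w z g f ↔
      f ∈ degreeSubgroup I p {a | zDeg w a = z ∧ gDeg q a = g} := by
  refine forall_congr' fun s => forall_congr' fun b => ?_
  rw [mem_support_iff_symCoeff_ne_zero, ← zDeg_add, ← gDeg_add]
  rfl

theorem cell_mem_degreeSubgroup {p : ℕ} {σ : Fin p ↪o Fin n} {u a : Fin n →₀ ℕ}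
    {D : Set (Fin n →₀ ℕ)} (ha : a ∈ D) (h : seqMon σ + u ≤ a) (c : k) :
    cell I σ u a c ∈ degreeSubgroup I p D := by
  intro s b hne
  obtain ⟨rfl, rfl, rfl⟩ := not_imp_comm.1 (fun h => symCoeff_cell_of_ne h c) hne
  rwa [add_tsub_cancel_of_le h]

/-- All cells in the boundary of a cell have the same total degree `a`, so `d` respects the grading
by monomials and any coarsening of it. -/
theorem d_mem_degreeSubgroup (hI : IsStable I) {p : ℕ} {D : Set (Fin n →₀ ℕ)} {f : L I (p + 1)}
    (hf : f ∈ degreeSubgroup I (p + 1) D) : d I p f ∈ degreeSubgroup I p D := by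
  rw [← sum_symTerm f, map_sum]
  refine sum_mem fun s _ => ?_
  rw [map_sum]
  refine sum_mem fun b hb => ?_
  have hD := hf s b (mem_support_iff_symCoeff_ne_zero.1 hb)
  rw [symTerm_eq_cell, d_cell hI s.adm.1 le_self_add]
  exact sum_mem fun r _ => zsmul_mem (sub_mem
    (cell_mem_degreeSubgroup hD (seqMon_removeTerm_add_le le_self_add r) _)
    (cell_mem_degreeSubgroup hD
      (hI.seqMon_removeTerm_add_decomp_le s.adm.1 le_self_add r) _)) _

theorem isHomogeneousShift_augmentation {w : Fin n → ℤ} {z : ℤ} {g : gradingGroup q} {f : L I 0}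
    (hf : IsHomogeneousL I 0 w z g f) :
    IsHomogeneousShift q w 0 z g (augmentation I f : SkewPoly q) := by
  intro a ha
  rw [← zDeg_add, ← gDeg_add, zero_add]
  by_contra hcon
  refine Finsupp.mem_support_iff.1 ha ?_
  change idealCoeff I a (augmentation I f) = 0
  rw [← sum_symTerm f]
  simp only [map_sum]
  refine Finset.sum_eq_zero fun s _ => Finset.sum_eq_zero fun b hb => ?_
  have hD := isHomogeneousL_iff.1 hf s b (mem_support_iff_symCoeff_ne_zero.1 hb)
  change coeffs q (augmentation I (symTerm s b _) : SkewPoly q) a = 0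
  rw [augmentation_symTerm, coeffs_term]
  refine Finsupp.single_eq_of_ne ?_
  rintro rfl
  simp only [seqMon, Finset.univ_eq_empty, Finset.sum_empty, zero_add] at hD
  exact hcon hD

end Grading

/-! ### Minimality -/

section Minimality

variable {n : ℕ} {k : Type*} [CommRing k] {q : Fin n → Fin n → kˣ} {I : TwoSidedIdeal (SkewPoly q)}

theorem term_mem_span_range_X {b : Fin n →₀ ℕ} (hb : b ≠ 0) (c : k) :
    term q b c ∈ TwoSidedIdeal.span (Set.range (X q)) := by
  obtain ⟨i, hi⟩ := Finsupp.support_nonempty_iff.2 hb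
  refine term_mem_of_le (u := Finsupp.single i 1) ?_ ?_ c
  · exact TwoSidedIdeal.subset_span (Set.mem_range_self (f := X q) i)
  · simpa [Nat.one_le_iff_ne_zero] using hi

theorem single_mem_mulIdeal {p : ℕ} (J : TwoSidedIdeal (SkewPoly q)) (s : AdmSymbol I p)
    {f : SkewPoly q} (hf : f ∈ J) : Finsupp.single s f ∈ mulIdeal J (L I p) := by
  rw [single_eq_smul_symbolBasis]
  exact Submodule.subset_span ⟨symbolBasis I p s, f, hf, rfl⟩

/-- Otherwise `x_{i_r} * u` would be a minimal generator, although it is a proper multiple of `u`.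
-/
theorem AdmSymbol.quotAt_ne_zero (hI : IsStable I) {p : ℕ} (s : AdmSymbol I p) (r : Fin p) :
    s.quotAt r ≠ 0 := by
  intro h0
  have hd := s.genAt_add_quotAt hI r
  rw [h0] at hd
  have hgen : s.gen = Finsupp.single (s.seq r) 1 + s.gen :=
    (hd.1.2 _ s.adm.1.1 (by rw [← add_zero (s.genAt r), ← hd.2.1]; exact le_add_self)).trans
      (by rw [hd.2.1, add_zero])
  have := DFunLike.congr_fun hgen (s.seq r)
  simp at this

theorem isMinimal (hI : IsStable I) : IsMinimal q (L I) (d I) := by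
  intro p
  rw [d, Module.Basis.constr_range, Submodule.span_le]
  rintro _ ⟨s, rfl⟩
  refine sub_mem (sum_mem fun r _ => ?_) (sum_mem fun r _ => ?_)
  · exact single_mem_mulIdeal _ _ (TwoSidedIdeal.mul_mem_left _ _ _
      (term_mem_span_range_X (by simp) _))
  · split_ifs with h
    · exact single_mem_mulIdeal _ _ (TwoSidedIdeal.mul_mem_left _ _ _
        (term_mem_span_range_X (s.quotAt_ne_zero hI r) _))
    · exact zero_mem _

end Minimality

end SkewEK

end

theorem mainTheorem1 {n : ℕ} {k : Type*} [CommRing k] [IsNoetherianRing k]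
    (q : Fin n → Fin n → kˣ) (hq : ∀ i, q i i = 1) (hq' : ∀ i j, q j i = (q i j)⁻¹)
    (I : TwoSidedIdeal (SkewEK.SkewPoly q)) (hI : SkewEK.IsStable I) :
    SkewEK.IsFreeResolution (R := SkewEK.SkewPoly q) (SkewEK.L I) (SkewEK.d I)
      (SkewEK.augmentation I) ∧
    (∀ w : Fin n → ℤ, (∀ i, 0 < w i) → ∀ (z : ℤ) (g : SkewEK.SkewPoly.gradingGroup q),
      (∀ (p : ℕ) (f : SkewEK.L I (p + 1)),
        SkewEK.IsHomogeneousL I (p + 1) w z g f →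
          SkewEK.IsHomogeneousL I p w z g (SkewEK.d I p f)) ∧
      (∀ f : SkewEK.L I 0, SkewEK.IsHomogeneousL I 0 w z g f →
        SkewEK.SkewPoly.IsHomogeneousShift q w 0 z g
          (SkewEK.augmentation I f : SkewEK.SkewPoly q))) ∧
    (IsField k → SkewEK.IsMinimal q (SkewEK.L I) (SkewEK.d I)) :=
  ⟨SkewEK.isFreeResolution hI, fun _ _ _ _ =>
    ⟨fun _ _ hf => SkewEK.isHomogeneousL_iff.2
      (SkewEK.d_mem_degreeSubgroup hI (SkewEK.isHomogeneousL_iff.1 hf)),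
      fun _ hf => SkewEK.isHomogeneousShift_augmentation hf⟩,
    fun _ => SkewEK.isMinimal hI⟩
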